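/- Theorem (generalized Barabási–Albert graph). Let $N$ be the number of edge types, $[N]=\{1,\dots,N\}$, and let $G_0=(V_0,E_0)$ be a deterministic finite graph with $s$ vertices and typed edges (multiple edges allowed, no loops) such that each type $k\in[N]$ occurs on at least one edge. For a graph $G_n=(V_n,E_n)$ let $E_n^{(k)}$ be the set of its edges of type $k$, let $\deg_n^{(k)}(v)$ be the number of edges of type $k$ connected to $v$, $\deg_n(v)=\sum_{k}\deg_n^{(k)}(v)$, and let $\mathbf{deg}_n(v)=(\deg_n^{(1)}(v),\dots,\deg_n^{(N)}(v))$ be the generalized degree of $v$. In step $n\ge 1$ a new vertex $v_n$ is added, so $V_n=V_0\cup\{v_1,\dots,v_n\}$, together with $M_n$ (not necessarily different) edges from $v_n$ to vertices of $V_{n-1}$. Let $\mathcal F_n$ be the $\sigma$-algebra generated by $G_1,\dots,G_n$ ($\mathcal F_0$ is trivial). Conditionally on $\mathcal F_{n-1}$ and $M_n$, the endpoints of the $M_n$ edges are chosen independently, each being $w\in V_{n-1}$ with probability proportional to $\deg_{n-1}(w)$; given the endpoints, the types of the edges are chosen independently, an edge with endpoint $w$ getting type $k$ with probability $\deg_{n-1}^{(k)}(w)/\deg_{n-1}(w)$.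 Assume: (BA1) for every $n\ge1$, $M_n$ is a positive integer valued random variable that is independent of $\mathcal F_{n-1}$; (BA2) there is a positive random variable $M$ such that $M_n\to M$ in distribution and, for every integer $p\ge1$, $\mathbb E(M_n^p)\to\mathbb E(M^p)<\infty$ as $n\to\infty$. Then for every $k\in[N]$ there is a random variable $\zeta^{(k)}$ with $|E_n^{(k)}|/|E_n|\to\zeta^{(k)}$ almost surely as $n\to\infty$, and for every $\boldsymbol d=(d_1,\dots,d_N)$ with nonnegative integer coordinates there is a random variable $x(\boldsymbol d)$ such that $$\lim_{n\to\infty}\frac{|\{v\in V_n:\mathbf{deg}_n(v)=\boldsymbol d\}|}{|V_n|}=x(\boldsymbol d)\quad\text{a.s.}$$ The random variables $x(\boldsymbol d)$ satisfy, almost surely, for every such $\boldsymbol d$, $$x(\boldsymbol d)=\sum_{k=1}^N\frac{d_k-1}{D+2}\,x(\boldsymbol d-\boldsymbol e_k)+\frac{2}{D+2}\,\mathbb P(M=D)\,\frac{D!}{\prod_{k=1}^N d_k!}\prod_{k=1}^N\bigl(\zeta^{(k)}\bigr)^{d_k},$$ where $D=\sum_{k=1}^N d_k$, $\boldsymbol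 e_k$ is the $k$th unit vector, $x(\boldsymbol d-\boldsymbol e_k)=0$ if $d_k=0$, and $0^0=1$. -/

import Mathlib

open MeasureTheory ProbabilityTheory Filter Topology
open scoped ENNReal

namespace MultiTypeBA

/-- Vertices: `Sum.inl i` (`i : Fin s`) are the `s` initial vertices, and `Sum.inr n` (`n ≥ 1`) is
the vertex born in step `n`. -/
abbrev Vertex (s : ℕ) : Type := Fin s ⊕ ℕ

/-- The vertex set after `n` steps: the initial vertices together with `v₁, …, vₙ`. -/
def vertexSet (s n : ℕ) : Finset (Vertex s) :=
  (Finset.univ : Finset (Fin s)).disjSum (Finset.Icc 1 n)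

/-- A finite collection of typed edges, with multiplicities; an edge is an unordered pair of
vertices together with its type in `Fin N`. -/
abbrev EdgeSet (α : Type) (N : ℕ) : Type := Multiset (Sym2 α × Fin N)

/-- The number of edges of type `k`. -/
def edgeCount {α : Type} {N : ℕ} (E : EdgeSet α N) (k : Fin N) : ℕ :=
  E.countP (fun e => e.2 = k)

/-- The generalized degree of `v`: its `k`th coordinate is the number of edges of type `k`
connected to `v`. -/
def typeDegree {α : Type} [DecidableEq α] {N : ℕ} (E : EdgeSet α N) (v : α) : Fin N → ℕ :=
  fun k => E.countP (fun e => v ∈ e.1 ∧ e.2 = k)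

/-- The degree of `v`: the number of edges, of any type, connected to `v`. -/
def degree {α : Type} [DecidableEq α] {N : ℕ} (E : EdgeSet α N) (v : α) : ℕ :=
  E.countP (fun e => v ∈ e.1)

/-- The number of vertices of generalized degree `d` in the graph with vertex set `V` and edges
`E`. -/
def numWithDegree {α : Type} [DecidableEq α] {N : ℕ} (V : Finset α) (E : EdgeSet α N)
    (d : Fin N → ℕ) : ℕ :=
  (V.filter (fun v => typeDegree E v = d)).card

/-- Admissible initial edges: no loops (multiple edges are allowed), and at least one edge of
every type. -/
structure IsInitial {s N : ℕ} (E₀ : EdgeSet (Fin s) N) : Prop where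
  loopless : ∀ e ∈ E₀, ¬ e.1.IsDiag
  edgeCount_pos : ∀ k, 0 < edgeCount E₀ k

/-- The edges after `n` steps. In step `n` the new vertex `vₙ` is joined, for every pair `(w, k)`
in the list `C n ω`, to the vertex `w` by an edge of type `k`. (`C 0` is not used.) -/
def edges {Ω : Type*} {s N : ℕ} (E₀ : EdgeSet (Fin s) N)
    (C : ℕ → Ω → List (Vertex s × Fin N)) : ℕ → Ω → EdgeSet (Vertex s) N
  | 0, _ => E₀.map (fun e => (e.1.map Sum.inl, e.2))
  | n + 1, ω => edges E₀ C n ω +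
      Multiset.ofList ((C (n + 1) ω).map (fun c => (s(Sum.inr (n + 1), c.1), c.2)))

/-- `ℱₙ`: the σ-algebra generated by the graphs `G₁, …, Gₙ`. -/
@[reducible] def history {Ω : Type*} {s N : ℕ} (E₀ : EdgeSet (Fin s) N)
    (C : ℕ → Ω → List (Vertex s × Fin N)) (n : ℕ) : MeasurableSpace Ω :=
  ⨆ i ∈ Finset.Icc 1 n, MeasurableSpace.comap (edges E₀ C i) ⊤

/-- `σ(ℱₙ, Mₙ₊₁)`. -/
@[reducible] def historyPlus {Ω : Type*} {s N : ℕ} (E₀ : EdgeSet (Fin s) N)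
    (C : ℕ → Ω → List (Vertex s × Fin N)) (M : ℕ → Ω → ℕ) (n : ℕ) : MeasurableSpace Ω :=
  history E₀ C n ⊔ MeasurableSpace.comap (M (n + 1)) ⊤

/-- The probability of choosing `w` among the vertices `V` proportionally to the degrees. -/
noncomputable def endpointProb {α : Type} [DecidableEq α] {N : ℕ} (V : Finset α)
    (E : EdgeSet α N) (w : α) : ℝ :=
  if w ∈ V then (degree E w : ℝ) / ∑ v ∈ V, (degree E v : ℝ) else 0

/-- The probability that a new edge ending in `w` gets type `k`: the proportion of type `k` among
the edges of `w`. (A vertex of degree `0` is never chosen as an endpoint.) -/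
noncomputable def typeProb {α : Type} [DecidableEq α] {N : ℕ}
    (E : EdgeSet α N) (w : α) (k : Fin N) : ℝ :=
  (typeDegree E w k : ℝ) / (degree E w : ℝ)

/-- The dynamics of the generalized Barabási–Albert graph. In step `n + 1`, the new vertex sends
`M (n + 1)` edges to old vertices; `C (n + 1)` lists their endpoints and types. Given the graphs
`G₁, …, Gₙ` and `M (n + 1)`, the endpoints are independent and chosen proportionally to the
degrees in `Gₙ`, and, given the endpoints, the types are independent and chosen according to the
proportions of the types at the endpoint in `Gₙ`. -/
structure IsGenBA {Ω : Type*} [MeasurableSpace Ω] (P : Measure Ω) {s N : ℕ}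
    (E₀ : EdgeSet (Fin s) N) (M : ℕ → Ω → ℕ) (C : ℕ → Ω → List (Vertex s × Fin N)) : Prop where
  measurable_M : ∀ n, Measurable (M (n + 1))
  measurable_C : ∀ n l, MeasurableSet {ω | C (n + 1) ω = l}
  length_C : ∀ n ω, (C (n + 1) ω).length = M (n + 1) ω
  condProb_C : ∀ n (l : List (Vertex s × Fin N)),
    P⟦{ω | C (n + 1) ω = l} | historyPlus E₀ C M n⟧ =ᵐ[P] fun ω =>
      if M (n + 1) ω = l.length then
        (l.map (fun c => endpointProb (vertexSet s n) (edges E₀ C n ω) c.1 *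
          typeProb (edges E₀ C n ω) c.1 c.2)).prod
      else 0

/-- Assumption (BA1): `Mₙ` is positive and independent of `ℱₙ₋₁`, for every `n ≥ 1`. -/
structure BA1 {Ω : Type*} [MeasurableSpace Ω] (P : Measure Ω) {s N : ℕ}
    (E₀ : EdgeSet (Fin s) N) (M : ℕ → Ω → ℕ) (C : ℕ → Ω → List (Vertex s × Fin N)) : Prop where
  pos : ∀ n, ∀ᵐ ω ∂P, 0 < M (n + 1) ω
  indep : ∀ n, Indep (MeasurableSpace.comap (M (n + 1)) ⊤) (history E₀ C n) P

/-- Assumption (BA2), for the limit variable `L`: `L` is positive, `Mₙ → L` in distribution, and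
`𝔼(Mₙᵖ) → 𝔼(Lᵖ) < ∞` for all integers `p ≥ 1`. -/
structure BA2 {Ω Ω' : Type*} [MeasurableSpace Ω] [MeasurableSpace Ω'] (P : Measure Ω)
    [IsProbabilityMeasure P] (P' : Measure Ω') [IsProbabilityMeasure P']
    (M : ℕ → Ω → ℕ) (L : Ω' → ℝ) : Prop where
  pos : ∀ᵐ ω ∂P', 0 < L ω
  tendsto_distribution :
    TendstoInDistribution (fun n ω => (M (n + 1) ω : ℝ)) atTop L (fun _ => P) P'
  moment_lt_top : ∀ p : ℕ, 1 ≤ p → ∫⁻ ω, ENNReal.ofReal (L ω) ^ p ∂P' < ∞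
  tendsto_moment : ∀ p : ℕ, 1 ≤ p →
    Tendsto (fun n => ∫⁻ ω, (M (n + 1) ω : ℝ≥0∞) ^ p ∂P) atTop
      (𝓝 (∫⁻ ω, ENNReal.ofReal (L ω) ^ p ∂P'))

end MultiTypeBA

namespace MultiTypeBA

/-! Write `D` for the total degree of `d`, `S_n` for the number of edges after step `n`, and
`X_n(d)` for the number of vertices of generalized degree `d`. The choices of endpoint and type
combine: a new edge ends at `w` and has type `k` with probability `deg_n^(k)(w) / (2 S_n)`
(`edgeProb_eq`). Summed over `w`, type `k` has probability equal to its current proportion. The type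
proportions therefore form a Pólya urn: they are bounded martingales and converge to `ζ k`. Given
the number of its edges, the new vertex has a multinomial degree vector with these proportions.

Per new edge, an old vertex of degree `d - e_k` reaches `d` with probability `(d_k - 1) / (2 S_n)`,
and one of degree `d` leaves it with probability `D / (2 S_n)`. Vertices that receive several edges
in one step contribute only `O(1 / S_n)`. Together with independence of `M_{n+1}` from the past,
this gives (`abs_condExp_increment_sub_le`) `E[X_{n+1}(d) - X_n(d) | ℱ_n] = E[M_{n+1}] (∑ (d_k - 1)
X_n(d - e_k) - D X_n(d)) / (2 S_n) + P(M_{n+1} = D) · multinomial + O(1 / S_n)`.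

Since `S_n / n` and `E[M_n]` have the same limit `μ`, this mean cancels. If `X_n(d) / n → x(d)`,
then `x(d) = (∑ (d_k - 1) x(d - e_k) - D x(d)) / 2 + P(M = D) · multinomial`, which is the asserted
recursion. Convergence follows by induction on `D`: the martingale law of large numbers
`ae_tendsto_sum_sub_condExp_div` makes the fluctuations negligible, and
`tendsto_div_nat_of_recursion` is applied to almost every path. -/

/-! ### Deterministic recursions and averages. -/

/-- After subtraction of the accumulated noise and of the linear term `c * n`, the remainder
satisfies the same recursion with an error tending to `0`. The factors `1 - γ n` eventually do not
expand, so a Cesàro average shows that the remainder is `o(n)`. -/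
theorem tendsto_div_nat_of_recursion {X γ β ξ : ℕ → ℝ} {a b : ℝ} (ha : 0 ≤ a)
    (hX : ∀ n, X (n + 1) = (1 - γ n) * X n + β n + ξ n) (hγ : ∀ n, 0 ≤ γ n)
    (hγa : Tendsto (fun n : ℕ => (n : ℝ) * γ n) atTop (𝓝 a)) (hβ : Tendsto β atTop (𝓝 b))
    (hξ : Tendsto (fun n : ℕ => (∑ i ∈ Finset.range n, ξ i) / (n : ℝ)) atTop (𝓝 0)) :
    Tendsto (fun n : ℕ => X n / (n : ℝ)) atTop (𝓝 (b / (1 + a))) := by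
  set Z : ℕ → ℝ := fun n => ∑ i ∈ Finset.range n, ξ i with hZ
  set c : ℝ := b / (1 + a) with hc
  set w : ℕ → ℝ := fun n => X n - Z n - c * n with hw
  set δ : ℕ → ℝ := fun n => β n - γ n * Z n - c - γ n * (c * n) with hδ
  have hwrec : ∀ n, w (n + 1) = (1 - γ n) * w n + δ n := by
    intro n
    simp only [hw, hδ, hZ, hX, Finset.sum_range_succ]
    push_cast
    ring
  have hδ0 : Tendsto δ atTop (𝓝 0) := by
    have h1 : Tendsto (fun n : ℕ => ((n : ℝ) * γ n) * (Z n / n)) atTop (𝓝 (a * 0)) := hγa.mul hξ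
    have h2 : Tendsto (fun n : ℕ => β n - ((n : ℝ) * γ n) * (Z n / n) - c - c * ((n : ℝ) * γ n))
        atTop (𝓝 (b - a * 0 - c - c * a)) :=
      ((hβ.sub h1).sub_const c).sub (hγa.const_mul c)
    -- This equation determines the slope `c = b / (1 + a)`.
    have h3 : b - a * 0 - c - c * a = 0 := by
      have : 1 + a ≠ 0 := by positivity
      rw [hc]; field_simp; ring
    rw [h3] at h2
    refine h2.congr' ?_
    filter_upwards [eventually_gt_atTop 0] with n hn
    have : (n : ℝ) ≠ 0 := by positivity
    simp only [hδ]
    field_simp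
  have hγ1 : ∀ᶠ n in atTop, |1 - γ n| ≤ 1 := by
    have h1 : ∀ᶠ n : ℕ in atTop, (n : ℝ) * γ n ≤ a + 1 := hγa.eventually_le_const (by linarith)
    have h2 : ∀ᶠ n : ℕ in atTop, a + 1 ≤ (n : ℝ) := tendsto_natCast_atTop_atTop.eventually_ge_atTop _
    filter_upwards [h1, h2] with n hn1 hn2
    have h3 : γ n ≤ 1 := by
      by_contra! h
      nlinarith
    rw [abs_le]
    constructor <;> linarith [hγ n]
  obtain ⟨n₀, hn₀⟩ := eventually_atTop.1 hγ1
  have hbound : ∀ n, n₀ ≤ n → |w n| ≤ |w n₀| + ∑ i ∈ Finset.range n, |δ i| := by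
    intro n hn
    induction n, hn using Nat.le_induction with
    | base => linarith [Finset.sum_nonneg (fun i (_ : i ∈ Finset.range n₀) => abs_nonneg (δ i))]
    | succ n hn ih =>
      rw [hwrec, Finset.sum_range_succ]
      have h1 := abs_add_le ((1 - γ n) * w n) (δ n)
      rw [abs_mul] at h1
      have h2 := mul_le_of_le_one_left (abs_nonneg (w n)) (hn₀ n hn)
      linarith
  have hces : Tendsto (fun n : ℕ => |w n₀| / (n : ℝ) + (n : ℝ)⁻¹ * ∑ i ∈ Finset.range n, |δ i|)
      atTop (𝓝 (0 + 0)) := by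
    refine Tendsto.add (tendsto_const_nhds.div_atTop tendsto_natCast_atTop_atTop) ?_
    have := hδ0.abs.cesaro
    rwa [abs_zero] at this
  rw [add_zero] at hces
  have hw0 : Tendsto (fun n : ℕ => w n / (n : ℝ)) atTop (𝓝 0) := by
    refine squeeze_zero_norm' ?_ hces
    filter_upwards [eventually_ge_atTop n₀, eventually_gt_atTop 0] with n hn hn0
    rw [Real.norm_eq_abs, abs_div, Nat.abs_cast, ← div_eq_inv_mul, ← add_div]
    have : (0 : ℝ) < n := by positivity
    gcongr
    exact hbound n hn
  have hfin : Tendsto (fun n : ℕ => w n / (n : ℝ) + Z n / n + c) atTop (𝓝 (0 + 0 + c)) :=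
    (hw0.add hξ).add_const c
  rw [add_zero, zero_add] at hfin
  refine hfin.congr' ?_
  filter_upwards [eventually_gt_atTop 0] with n hn0
  have : (n : ℝ) ≠ 0 := by positivity
  simp only [hw]
  field_simp
  ring

/-- Kronecker's lemma for the weights `1 / (n + 1)`. -/
theorem tendsto_sum_div_nat_of_tendsto_sum_div {ξ : ℕ → ℝ} {c : ℝ}
    (h : Tendsto (fun n => ∑ i ∈ Finset.range n, ξ i / ((i : ℝ) + 1)) atTop (𝓝 c)) :
    Tendsto (fun n : ℕ => (∑ i ∈ Finset.range n, ξ i) / (n : ℝ)) atTop (𝓝 0) := by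
  set Y : ℕ → ℝ := fun n => ∑ i ∈ Finset.range n, ξ i / ((i : ℝ) + 1) with hY
  -- Summation by parts: after division by `n`, both terms on the right have limit `c`.
  have key : ∀ n : ℕ, ∑ i ∈ Finset.range n, ξ i = n * Y n - ∑ i ∈ Finset.range n, Y i := by
    intro n
    induction n with
    | zero => simp
    | succ n ih =>
      have h1 : Y (n + 1) = Y n + ξ n / ((n : ℝ) + 1) := by simp [hY, Finset.sum_range_succ]
      have h2 : ((n : ℝ) + 1) ≠ 0 := by positivity
      rw [Finset.sum_range_succ, Finset.sum_range_succ, ih, h1]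
      push_cast
      field_simp
      ring
  have h1 := h.sub h.cesaro
  rw [sub_self] at h1
  refine h1.congr' ?_
  filter_upwards [eventually_gt_atTop 0] with n hn
  have : (n : ℝ) ≠ 0 := by positivity
  rw [key]
  field_simp

/-! ### A strong law for martingale differences. -/

section MartingaleLaw

variable {Ω : Type*} {m0 : MeasurableSpace Ω}

/-- The conditional variance is at most the conditional second moment; integrate. -/
theorem integral_sub_condExp_sq_le {P : Measure Ω} [IsProbabilityMeasure P]
    {m : MeasurableSpace Ω} (hm : m ≤ m0) {f : Ω → ℝ} (hf : MemLp f 2 P) :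
    ∫ ω, (f ω - (P[f | m]) ω) ^ 2 ∂P ≤ ∫ ω, f ω ^ 2 ∂P := by
  have h1 := integral_mono_ae integrable_condVar integrable_condExp (condVar_ae_le_condExp_sq hm hf)
  rw [condVar, integral_condExp hm, integral_condExp hm] at h1
  exact h1

/-- Martingale differences are orthogonal: conditioning on `ℱ n` makes the cross term vanish. -/
theorem integral_sq_sum_le {P : Measure Ω} [IsProbabilityMeasure P] {ℱ : Filtration ℕ m0}
    {η : ℕ → Ω → ℝ} (hη : ∀ i, StronglyMeasurable[ℱ (i + 1)] (η i)) (hη2 : ∀ i, MemLp (η i) 2 P)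
    (hη0 : ∀ i, P[η i | ℱ i] =ᵐ[P] 0) (n : ℕ) :
    ∫ ω, (∑ i ∈ Finset.range n, η i ω) ^ 2 ∂P ≤ ∑ i ∈ Finset.range n, ∫ ω, η i ω ^ 2 ∂P := by
  induction n with
  | zero => simp
  | succ n ih =>
    set Y : Ω → ℝ := fun ω => ∑ i ∈ Finset.range n, η i ω with hY
    have hYm : StronglyMeasurable[ℱ n] Y := by
      refine Finset.stronglyMeasurable_fun_sum _ fun i hi => (hη i).mono (ℱ.mono ?_)
      have := Finset.mem_range.1 hi
      omega
    have hY2 : MemLp Y 2 P := memLp_finsetSum _ fun i _ => hη2 i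
    have hint : Integrable (Y * η n) P := hY2.integrable_mul (hη2 n)
    have hcross : ∫ ω, Y ω * η n ω ∂P = 0 := by
      have h1 := condExp_mul_of_stronglyMeasurable_left hYm hint ((hη2 n).integrable one_le_two)
      have h2 := integral_condExp (μ := P) (f := Y * η n) (ℱ.le n)
      have h3 : P[Y * η n | ℱ n] =ᵐ[P] 0 := by
        filter_upwards [h1, hη0 n] with ω hω1 hω2
        simp [hω1, hω2]
      rw [integral_congr_ae h3] at h2
      simpa using h2.symm
    have hsplit : ∀ ω, (∑ i ∈ Finset.range (n + 1), η i ω) ^ 2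
        = Y ω ^ 2 + (2 * (Y ω * η n ω) + η n ω ^ 2) := by
      intro ω
      rw [Finset.sum_range_succ]
      simp only [hY]
      ring
    have hint' : Integrable (fun ω => Y ω * η n ω) P := hint
    have hint2 : Integrable (fun ω => 2 * (Y ω * η n ω) + η n ω ^ 2) P :=
      (hint'.const_mul 2).add (hη2 n).integrable_sq
    simp_rw [hsplit]
    rw [integral_add hY2.integrable_sq hint2,
      integral_add (hint'.const_mul 2) (hη2 n).integrable_sq, integral_const_mul, hcross,
      Finset.sum_range_succ]
    linarith

/-- A strong law of large numbers for martingale differences: the averages of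
`f i - P[f i | ℱ i]` tend to `0` if the second moments of the `f i` are eventually bounded. -/
theorem ae_tendsto_sum_sub_condExp_div {P : Measure Ω} [IsProbabilityMeasure P]
    {ℱ : Filtration ℕ m0} {f : ℕ → Ω → ℝ} {n₀ : ℕ} {B : ℝ}
    (hf : ∀ i, StronglyMeasurable[ℱ (i + 1)] (f i))
    (hf2 : ∀ i, n₀ ≤ i → MemLp (f i) 2 P) (hB : ∀ i, n₀ ≤ i → ∫ ω, f i ω ^ 2 ∂P ≤ B) :
    ∀ᵐ ω ∂P, Tendsto (fun n : ℕ => (∑ i ∈ Finset.range n, (f i ω - (P[f i | ℱ i]) ω)) / (n : ℝ))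
      atTop (𝓝 0) := by
  -- The weights `1 / (i + 1)` make the variances summable and prepare for Kronecker's lemma. Terms
  -- before `n₀`, whose second moments are not controlled, are set to `0`; they are added back to
  -- each path at the end.
  set η : ℕ → Ω → ℝ := fun i ω =>
    if n₀ ≤ i then (f i ω - (P[f i | ℱ i]) ω) / ((i : ℝ) + 1) else 0 with hηdef
  have hsm : ∀ i, StronglyMeasurable[ℱ (i + 1)] fun ω => f i ω - (P[f i | ℱ i]) ω := fun i =>
    (hf i).sub (stronglyMeasurable_condExp.mono (ℱ.mono (Nat.le_succ i)))
  have hη : ∀ i, StronglyMeasurable[ℱ (i + 1)] (η i) := by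
    intro i
    by_cases hi : n₀ ≤ i
    · simp only [hηdef, hi, if_true, div_eq_mul_inv]
      exact (hsm i).mul_const _
    · simp only [hηdef, hi, if_false]
      exact stronglyMeasurable_const
  have hη2 : ∀ i, MemLp (η i) 2 P := by
    intro i
    by_cases hi : n₀ ≤ i
    · simp only [hηdef, hi, if_true, div_eq_mul_inv]
      exact ((hf2 i hi).sub ((hf2 i hi).condExp one_le_two)).mul_const _
    · simp only [hηdef, hi, if_false]
      exact MemLp.zero
  have hη0 : ∀ i, P[η i | ℱ i] =ᵐ[P] 0 := by
    intro i
    by_cases hi : n₀ ≤ i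
    · have hint : Integrable (f i) P := (hf2 i hi).integrable one_le_two
      have h0 : η i = ((i : ℝ) + 1)⁻¹ • (f i - P[f i | ℱ i]) := by
        ext ω
        simp [hηdef, hi, div_eq_inv_mul]
      rw [h0]
      refine (condExp_smul _ _ _).trans ?_
      have h1 := condExp_sub hint (integrable_condExp (m := ℱ i) (f := f i)) (ℱ i)
      have h2 : P[P[f i | ℱ i] | ℱ i] = P[f i | ℱ i] :=
        condExp_of_stronglyMeasurable (ℱ.le i) stronglyMeasurable_condExp integrable_condExp
      rw [h2] at h1
      filter_upwards [h1] with ω hω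
      simp [hω]
    · have h0 : η i = 0 := by
        ext ω
        simp [hηdef, hi]
      rw [h0, condExp_zero]
  have hηB : ∀ i, ∫ ω, η i ω ^ 2 ∂P ≤ |B| * (1 / (((i + 1 : ℕ) : ℝ)) ^ 2) := by
    intro i
    by_cases hi : n₀ ≤ i
    · simp only [hηdef, hi, if_true, div_pow]
      rw [integral_div, div_eq_mul_one_div]
      push_cast
      gcongr
      exact (integral_sub_condExp_sq_le (ℱ.le i) (hf2 i hi)).trans ((hB i hi).trans (le_abs_self B))
    · simp only [hηdef, hi, if_false]
      simp only [ne_eq, OfNat.ofNat_ne_zero, not_false_eq_true, zero_pow, integral_zero]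
      positivity
  have hsumm : Summable fun i : ℕ => |B| * (1 / (((i + 1 : ℕ) : ℝ)) ^ 2) :=
    ((summable_nat_add_iff 1).2 (Real.summable_one_div_nat_pow.2 one_lt_two)).mul_left _
  set K : ℝ := ∑' i : ℕ, |B| * (1 / (((i + 1 : ℕ) : ℝ)) ^ 2) with hK
  set Y : ℕ → Ω → ℝ := fun n ω => ∑ i ∈ Finset.range n, η i ω with hY
  have hY2 : ∀ n, MemLp (Y n) 2 P := fun n => memLp_finsetSum _ fun i _ => hη2 i
  have hYK : ∀ n, ∫ ω, Y n ω ^ 2 ∂P ≤ K := fun n =>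
    (integral_sq_sum_le hη hη2 hη0 n).trans ((Finset.sum_le_sum fun i _ => hηB i).trans
      (hsumm.sum_le_tsum _ fun i _ => by positivity))
  have hYmart : Martingale Y ℱ P := by
    refine martingale_of_condExp_sub_eq_zero_nat ?_ ?_ ?_
    · intro n
      refine Finset.stronglyMeasurable_fun_sum _ fun i hi => (hη i).mono (ℱ.mono ?_)
      have := Finset.mem_range.1 hi
      omega
    · exact fun n => (hY2 n).integrable one_le_two
    · intro n
      have : Y (n + 1) - Y n = η n := by
        ext ω
        simp [hY, Finset.sum_range_succ]
      rw [this]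
      exact hη0 n
  -- `L²` boundedness gives `L¹` boundedness through `|y| ≤ 1 + y²`, so Doob's convergence theorem
  -- applies.
  have hYbdd : ∀ n, eLpNorm (Y n) 1 P ≤ ((1 + K).toNNReal : ℝ≥0∞) := by
    intro n
    have hi : Integrable (Y n) P := (hY2 n).integrable one_le_two
    rw [eLpNorm_one_eq_lintegral_enorm, ← ofReal_integral_norm_eq_lintegral_enorm hi]
    refine ENNReal.ofReal_le_ofReal ?_
    have h1 : ∫ ω, ‖Y n ω‖ ∂P ≤ ∫ ω, (1 + Y n ω ^ 2) ∂P := by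
      refine integral_mono hi.norm ((integrable_const 1).add (hY2 n).integrable_sq) fun ω => ?_
      rw [Real.norm_eq_abs]
      change |Y n ω| ≤ 1 + Y n ω ^ 2
      nlinarith [sq_nonneg (|Y n ω| - 1), sq_abs (Y n ω), abs_nonneg (Y n ω)]
    rw [integral_add (integrable_const 1) (hY2 n).integrable_sq] at h1
    simp only [integral_const, probReal_univ, smul_eq_mul, mul_one] at h1
    linarith [hYK n]
  filter_upwards [hYmart.submartingale.exists_ae_tendsto_of_bdd hYbdd] with ω ⟨c, hc⟩
  set ξ : ℕ → ℝ := fun i => f i ω - (P[f i | ℱ i]) ω with hξ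
  have h1 : Tendsto (fun n => ∑ i ∈ Finset.range n, ξ i / ((i : ℝ) + 1)) atTop
      (𝓝 (c + ∑ i ∈ Finset.range n₀, ξ i / ((i : ℝ) + 1))) := by
    refine (hc.add_const _).congr' ?_
    filter_upwards [eventually_ge_atTop n₀] with n hn
    have h2 : Y n ω = ∑ i ∈ Finset.Ico n₀ n, ξ i / ((i : ℝ) + 1) := by
      simp only [hY, hηdef]
      rw [← Finset.sum_filter]
      congr 1
      ext i
      simp [Finset.mem_Ico, and_comm]
    rw [h2, add_comm, Finset.sum_range_add_sum_Ico _ hn]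
  exact tendsto_sum_div_nat_of_tendsto_sum_div h1

end MartingaleLaw

/-! ### Expectations over lists of independent entries, as finite sums. -/

section ListMean

variable {β : Type*} [DecidableEq β]

/-- The lists of length `m` with entries in `A`. -/
def listsOfLength (A : Finset β) : ℕ → Finset (List β)
  | 0 => {[]}
  | m + 1 => (A ×ˢ listsOfLength A m).image fun q => q.1 :: q.2

theorem mem_listsOfLength {A : Finset β} {m : ℕ} {l : List β} :
    l ∈ listsOfLength A m ↔ l.length = m ∧ ∀ c ∈ l, c ∈ A := by
  induction m generalizing l with
  | zero =>
    simp only [listsOfLength, Finset.mem_singleton, List.length_eq_zero_iff]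
    constructor
    · rintro rfl
      simp
    · exact fun h => h.1
  | succ m ih =>
    cases l with
    | nil => simp [listsOfLength]
    | cons c l =>
      simp only [listsOfLength, Finset.mem_image, Finset.mem_product, Prod.exists, List.cons.injEq,
        List.length_cons, List.mem_cons, forall_eq_or_imp, add_left_inj]
      constructor
      · rintro ⟨a, b, ⟨h1, h2⟩, rfl, rfl⟩
        exact ⟨(ih.1 h2).1, h1, (ih.1 h2).2⟩
      · rintro ⟨h1, h2, h3⟩
        exact ⟨c, l, ⟨h2, ih.2 ⟨h1, h3⟩⟩, rfl, rfl⟩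

/-- The expectation of `F` over lists of `m` independent entries with distribution `p` on `A`. -/
def listMean (A : Finset β) (p : β → ℝ) (m : ℕ) (F : List β → ℝ) : ℝ :=
  ∑ l ∈ listsOfLength A m, (l.map p).prod * F l

variable {A : Finset β} {p : β → ℝ}

theorem listMean_zero (F : List β → ℝ) : listMean A p 0 F = F [] := by
  simp [listMean, listsOfLength]

theorem listMean_succ (m : ℕ) (F : List β → ℝ) :
    listMean A p (m + 1) F = ∑ c ∈ A, p c * listMean A p m fun l => F (c :: l) := by
  simp only [listMean, listsOfLength]
  rw [Finset.sum_image, Finset.sum_product]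
  · refine Finset.sum_congr rfl fun c _ => ?_
    rw [Finset.mul_sum]
    refine Finset.sum_congr rfl fun l _ => ?_
    simp only [List.map_cons, List.prod_cons]
    ring
  · rintro ⟨a, b⟩ _ ⟨a', b'⟩ _ h
    simpa using h

theorem listMean_congr {m : ℕ} {F G : List β → ℝ} (h : ∀ l, l.length = m → F l = G l) :
    listMean A p m F = listMean A p m G :=
  Finset.sum_congr rfl fun l hl => by rw [h l (mem_listsOfLength.1 hl).1]

theorem listMean_add (m : ℕ) (F G : List β → ℝ) :
    (listMean A p m fun l => F l + G l) = listMean A p m F + listMean A p m G := by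
  simp [listMean, mul_add, Finset.sum_add_distrib]

theorem listMean_mul_const (m : ℕ) (F : List β → ℝ) (c : ℝ) :
    (listMean A p m fun l => F l * c) = listMean A p m F * c := by
  simp only [listMean, Finset.sum_mul, mul_assoc]

theorem listMean_sum {ι : Type*} (S : Finset ι) (m : ℕ) (F : ι → List β → ℝ) :
    (listMean A p m fun l => ∑ i ∈ S, F i l) = ∑ i ∈ S, listMean A p m (F i) := by
  simp only [listMean, Finset.mul_sum]
  exact Finset.sum_comm

theorem listMean_const (hp : ∑ c ∈ A, p c = 1) (m : ℕ) (c : ℝ) :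
    (listMean A p m fun _ => c) = c := by
  induction m with
  | zero => rw [listMean_zero]
  | succ m ih => rw [listMean_succ, ih, ← Finset.sum_mul, hp, one_mul]

theorem listMean_sub (m : ℕ) (F G : List β → ℝ) :
    (listMean A p m fun l => F l - G l) = listMean A p m F - listMean A p m G := by
  simp [listMean, mul_sub, Finset.sum_sub_distrib]

theorem listMean_mono (hp : ∀ c ∈ A, 0 ≤ p c) {m : ℕ} {F G : List β → ℝ} (h : ∀ l, F l ≤ G l) :
    listMean A p m F ≤ listMean A p m G := by
  refine Finset.sum_le_sum fun l hl => mul_le_mul_of_nonneg_left (h l) (List.prod_nonneg ?_)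
  intro x hx
  obtain ⟨c, hc, rfl⟩ := List.mem_map.1 hx
  exact hp c ((mem_listsOfLength.1 hl).2 c hc)

end ListMean

/-! ### How the degree vector of one old vertex changes in a step. -/

section Occupation

variable {α : Type*} [DecidableEq α] {N : ℕ} {V : Finset α} {p : α × Fin N → ℝ}

/-- The probability that the degree vector `a` of `w` becomes `d` after `m` attachments. -/
def hitProb (V : Finset α) (p : α × Fin N → ℝ) (w : α) (d : Fin N → ℕ) (m : ℕ)
    (a : Fin N → ℕ) : ℝ :=
  listMean (V ×ˢ Finset.univ) p m fun l => if (a + fun k => l.count (w, k)) = d then 1 else 0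

theorem hitProb_zero (w : α) (d a : Fin N → ℕ) :
    hitProb V p w d 0 a = if a = d then 1 else 0 := by
  rw [hitProb, listMean_zero]
  congr 2

/-- Condition on the first attachment: it changes `a` only if it ends at `w`. The law `p` stays
fixed, since all edges of a step are drawn from the same old graph. -/
theorem hitProb_succ (hp : ∑ c ∈ V ×ˢ Finset.univ, p c = 1) {w : α} (hw : w ∈ V)
    (d : Fin N → ℕ) (m : ℕ) (a : Fin N → ℕ) :
    hitProb V p w d (m + 1) a = hitProb V p w d m a +
      ∑ k, p (w, k) * (hitProb V p w d m (a + Pi.single k 1) - hitProb V p w d m a) := by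
  have hstep : ∀ v k, (listMean (V ×ˢ Finset.univ) p m fun l =>
      if (a + fun j => ((v, k) :: l).count (w, j)) = d then (1 : ℝ) else 0) =
      hitProb V p w d m a + if v = w then
        hitProb V p w d m (a + Pi.single k 1) - hitProb V p w d m a else 0 := by
    intro v k
    by_cases hv : v = w
    · subst hv
      simp only [if_true, add_sub_cancel]
      refine listMean_congr fun l _ => ?_
      have : (fun j => ((v, k) :: l).count (v, j)) = Pi.single k 1 + fun j => l.count (v, j) := by
        ext j
        by_cases hj : k = j
        · subst hj; simp [add_comm]
        · simp [hj, Ne.symm hj]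
      rw [this, add_assoc]
    · simp only [hv, if_false, add_zero]
      refine listMean_congr fun l _ => ?_
      have : (fun j => ((v, k) :: l).count (w, j)) = fun j => l.count (w, j) := by
        ext j
        simp [hv]
      rw [this]
  rw [hitProb, listMean_succ]
  have h1 : ∀ c ∈ V ×ˢ (Finset.univ : Finset (Fin N)), (p c * listMean (V ×ˢ Finset.univ) p m
      fun l => if (a + fun j => (c :: l).count (w, j)) = d then (1 : ℝ) else 0) =
      p c * hitProb V p w d m a + if c.1 = w then p c *
        (hitProb V p w d m (a + Pi.single c.2 1) - hitProb V p w d m a) else 0 := by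
    rintro ⟨v, k⟩ _
    rw [hstep, mul_add, mul_ite, mul_zero]
  rw [Finset.sum_congr rfl h1, Finset.sum_add_distrib, ← Finset.sum_mul, hp, one_mul,
    Finset.sum_product, Finset.sum_eq_single w]
  · simp
  · intro v _ hv
    simp [hv]
  · exact fun h => absurd hw h

theorem hitProb_mem (hp : ∑ c ∈ V ×ˢ Finset.univ, p c = 1)
    (hp0 : ∀ c ∈ V ×ˢ (Finset.univ : Finset (Fin N)), 0 ≤ p c) (w : α)
    (d : Fin N → ℕ) (m : ℕ) (a : Fin N → ℕ) :
    0 ≤ hitProb V p w d m a ∧ hitProb V p w d m a ≤ 1 := by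
  constructor
  · rw [← listMean_const hp m 0]
    exact listMean_mono hp0 fun l => by split_ifs <;> norm_num
  · rw [← listMean_const hp m 1]
    exact listMean_mono hp0 fun l => by split_ifs <;> norm_num

/-- Union bound: each of the `m` attachments ends at `w` with probability `∑ k, p (w, k)`. -/
theorem abs_hitProb_sub_le (hp : ∑ c ∈ V ×ˢ Finset.univ, p c = 1)
    (hp0 : ∀ c ∈ V ×ˢ (Finset.univ : Finset (Fin N)), 0 ≤ p c) {w : α} (hw : w ∈ V)
    (d : Fin N → ℕ) (m : ℕ) (a : Fin N → ℕ) :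
    |hitProb V p w d m a - hitProb V p w d 0 a| ≤ m * ∑ k, p (w, k) := by
  have hpw : ∀ k, 0 ≤ p (w, k) := fun k => hp0 _ (by simp [hw])
  induction m with
  | zero => simp
  | succ m ih =>
    rw [hitProb_succ hp hw, add_sub_right_comm]
    refine (abs_add_le _ _).trans ?_
    push_cast
    rw [add_mul, one_mul]
    refine add_le_add ih ((Finset.abs_sum_le_sum_abs _ _).trans (Finset.sum_le_sum fun k _ => ?_))
    rw [abs_mul, abs_of_nonneg (hpw k)]
    refine mul_le_of_le_one_right (hpw k) ?_
    have h1 := hitProb_mem hp hp0 w d m (a + Pi.single k 1)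
    have h2 := hitProb_mem hp hp0 w d m a
    rw [abs_le]
    constructor <;> linarith [h1.1, h1.2, h2.1, h2.2]

/-- To first order the attachments act separately; the deviation is due to `w` being hit at least
twice and is quadratic in its hitting probability. -/
theorem abs_hitProb_sub_linear_le (hp : ∑ c ∈ V ×ˢ Finset.univ, p c = 1)
    (hp0 : ∀ c ∈ V ×ˢ (Finset.univ : Finset (Fin N)), 0 ≤ p c) {w : α} (hw : w ∈ V)
    (d : Fin N → ℕ) (m : ℕ) (a : Fin N → ℕ) :
    |hitProb V p w d m a - hitProb V p w d 0 a -
      m * ∑ k, p (w, k) * (hitProb V p w d 0 (a + Pi.single k 1) - hitProb V p w d 0 a)| ≤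
      m ^ 2 * (∑ k, p (w, k)) ^ 2 := by
  have hpw : ∀ k, 0 ≤ p (w, k) := fun k => hp0 _ (by simp [hw])
  set q : ℝ := ∑ k, p (w, k) with hq
  have hq0 : 0 ≤ q := Finset.sum_nonneg fun k _ => hpw k
  induction m with
  | zero => simp
  | succ m ih =>
    have h1 : |∑ k, p (w, k) * ((hitProb V p w d m (a + Pi.single k 1)
        - hitProb V p w d 0 (a + Pi.single k 1)) - (hitProb V p w d m a - hitProb V p w d 0 a))| ≤
        q * (2 * (m * q)) := by
      rw [hq, Finset.sum_mul]
      refine (Finset.abs_sum_le_sum_abs _ _).trans (Finset.sum_le_sum fun k _ => ?_)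
      rw [abs_mul, abs_of_nonneg (hpw k)]
      refine mul_le_mul_of_nonneg_left ((abs_sub _ _).trans ?_) (hpw k)
      have h2 := abs_hitProb_sub_le hp hp0 hw d m (a + Pi.single k 1)
      have h3 := abs_hitProb_sub_le hp hp0 hw d m a
      linarith
    have h4 : hitProb V p w d (m + 1) a - hitProb V p w d 0 a - ((m + 1 : ℕ) : ℝ) *
        ∑ k, p (w, k) * (hitProb V p w d 0 (a + Pi.single k 1) - hitProb V p w d 0 a) =
        (hitProb V p w d m a - hitProb V p w d 0 a -
          m * ∑ k, p (w, k) * (hitProb V p w d 0 (a + Pi.single k 1) - hitProb V p w d 0 a)) +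
        ∑ k, p (w, k) * ((hitProb V p w d m (a + Pi.single k 1)
        - hitProb V p w d 0 (a + Pi.single k 1)) - (hitProb V p w d m a - hitProb V p w d 0 a)) := by
      rw [hitProb_succ hp hw]
      simp only [mul_sub, Finset.sum_sub_distrib]
      push_cast
      ring
    rw [h4]
    refine (abs_add_le _ _).trans ((add_le_add ih h1).trans ?_)
    push_cast
    -- The induction closes because `m² + 2m ≤ (m + 1)²`.
    nlinarith [sq_nonneg q]

/-- Degrees never decrease. This confines the quadratic errors to vertices of total degree at most
that of `d`. -/
theorem hitProb_eq_zero {w : α} {d : Fin N → ℕ} {a : Fin N → ℕ} (h : ∑ k, d k < ∑ k, a k) (m : ℕ) :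
    hitProb V p w d m a = 0 := by
  rw [hitProb]
  refine Finset.sum_eq_zero fun l _ => ?_
  beta_reduce
  rw [if_neg, mul_zero]
  rintro rfl
  simp only [Pi.add_apply, Finset.sum_add_distrib] at h
  omega

end Occupation

/-! ### Multinomial law of the types of the new edges. -/

section Types

variable {α : Type*} {N : ℕ}

/-- The numbers of entries of each type in a list of typed endpoints. -/
def typeCount (l : List (α × Fin N)) : Fin N → ℕ :=
  fun k => l.countP fun c => c.2 = k

theorem typeCount_cons (c : α × Fin N) (l : List (α × Fin N)) :
    typeCount (c :: l) = typeCount l + Pi.single c.2 1 := by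
  ext k
  by_cases hk : c.2 = k
  · subst hk; simp [typeCount]
  · simp [typeCount, hk, Ne.symm hk]

theorem add_single_eq_iff {a d : Fin N → ℕ} {k : Fin N} :
    a + Pi.single k 1 = d ↔ d k ≠ 0 ∧ a = d - Pi.single k 1 := by
  constructor
  · rintro rfl
    simp
  · rintro ⟨h, rfl⟩
    ext j
    by_cases hj : j = k
    · subst hj; simp; omega
    · simp [hj]

theorem sum_sub_single {d : Fin N → ℕ} {k : Fin N} (h : d k ≠ 0) :
    ∑ i, (d - Pi.single k 1 : Fin N → ℕ) i + 1 = ∑ i, d i := by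
  have h1 : (d - Pi.single k 1 : Fin N → ℕ) + Pi.single k 1 = d := add_single_eq_iff.2 ⟨h, rfl⟩
  conv_rhs => rw [← h1]
  simp [Finset.sum_add_distrib]

theorem prod_factorial_sub_single {d : Fin N → ℕ} {k : Fin N} (h : d k ≠ 0) :
    ∏ i, (((d i).factorial : ℕ) : ℝ) =
      d k * ∏ i, ((((d - Pi.single k 1 : Fin N → ℕ) i).factorial : ℕ) : ℝ) := by
  refine (Finset.mul_prod_erase _ _ (Finset.mem_univ k)).symm.trans (Eq.trans ?_
    (congrArg _ (Finset.mul_prod_erase Finset.univ _ (Finset.mem_univ k))))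
  rw [← mul_assoc]
  congr 1
  · simp only [Pi.sub_apply, Pi.single_eq_same]
    rw [← Nat.mul_factorial_pred h]
    push_cast
    rfl
  · refine Finset.prod_congr rfl fun i hi => ?_
    simp [Finset.ne_of_mem_erase hi]

theorem prod_pow_sub_single {d : Fin N → ℕ} {k : Fin N} (h : d k ≠ 0) (π : Fin N → ℝ) :
    ∏ i, π i ^ d i = π k * ∏ i, π i ^ (d - Pi.single k 1 : Fin N → ℕ) i := by
  refine (Finset.mul_prod_erase _ _ (Finset.mem_univ k)).symm.trans (Eq.trans ?_
    (congrArg _ (Finset.mul_prod_erase Finset.univ _ (Finset.mem_univ k))))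
  rw [← mul_assoc]
  congr 1
  · simp only [Pi.sub_apply, Pi.single_eq_same]
    rw [mul_pow_sub_one h]
  · refine Finset.prod_congr rfl fun i hi => ?_
    simp [Finset.ne_of_mem_erase hi]

/-- The multinomial probability of the vector `d`. -/
noncomputable def multinomialProb (π : Fin N → ℝ) (d : Fin N → ℕ) : ℝ :=
  ((∑ i, d i).factorial : ℝ) / (∏ k, ((d k).factorial : ℝ)) * ∏ k, π k ^ d k

/-- Conditioning on the type of one edge: the term of type `k` is the fraction `d k / (m + 1)` of
the multinomial probability, and these fractions add up to `1`. -/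
theorem multinomialProb_rec (π : Fin N → ℝ) {d : Fin N → ℕ} {m : ℕ} (hd : ∑ i, d i = m + 1) :
    ∑ k, π k * (if d k = 0 then 0 else multinomialProb π (d - Pi.single k 1)) =
      multinomialProb π d := by
  have hterm : ∀ k, π k * (if d k = 0 then 0 else multinomialProb π (d - Pi.single k 1)) =
      (d k : ℝ) * ((m.factorial : ℝ) / (∏ i, ((d i).factorial : ℝ)) * ∏ i, π i ^ d i) := by
    intro k
    by_cases hk : d k = 0
    · simp [hk]
    · have hm : ∑ i, (d - Pi.single k 1 : Fin N → ℕ) i = m := by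
        have := sum_sub_single hk
        omega
      have h1 : (d k : ℝ) ≠ 0 := by exact_mod_cast hk
      have h2 : ∏ i, ((((d - Pi.single k 1 : Fin N → ℕ) i).factorial : ℕ) : ℝ) ≠ 0 :=
        Finset.prod_ne_zero_iff.2 fun i _ => by positivity
      rw [if_neg hk, multinomialProb, hm, prod_factorial_sub_single hk, prod_pow_sub_single hk]
      field_simp
  rw [Finset.sum_congr rfl fun k _ => hterm k, ← Finset.sum_mul, multinomialProb, hd,
    Nat.factorial_succ, ← hd]
  push_cast
  ring

variable [DecidableEq α] {V : Finset α} {p : α × Fin N → ℝ}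

/-- Forgetting the endpoints leaves independent types with the marginal law of `p`; induction on the
first edge matches `multinomialProb_rec`. -/
theorem listMean_typeCount_eq (m : ℕ) (d : Fin N → ℕ) :
    (listMean (V ×ˢ Finset.univ) p m fun l => if typeCount l = d then 1 else 0) =
      if ∑ i, d i = m then multinomialProb (fun k => ∑ v ∈ V, p (v, k)) d else 0 := by
  induction m generalizing d with
  | zero =>
    rw [listMean_zero]
    by_cases hd : d = 0
    · subst hd
      have : typeCount ([] : List (α × Fin N)) = 0 := rfl
      simp [this, multinomialProb]
    · have h1 : ¬ ∑ i, d i = 0 := fun h => hd (by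
        ext i
        exact Finset.sum_eq_zero_iff.1 h i (Finset.mem_univ i))
      have h2 : ¬ typeCount ([] : List (α × Fin N)) = d := fun h => hd h.symm
      rw [if_neg h1, if_neg h2]
  | succ m ih =>
    have h1 : ∀ c : α × Fin N, (listMean (V ×ˢ Finset.univ) p m fun l =>
        if typeCount (c :: l) = d then (1 : ℝ) else 0) = if d c.2 = 0 then 0 else
          if ∑ i, d i = m + 1 then
            multinomialProb (fun k => ∑ v ∈ V, p (v, k)) (d - Pi.single c.2 1) else 0 := by
      intro c
      by_cases hc : d c.2 = 0
      · rw [if_pos hc]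
        refine Finset.sum_eq_zero fun l _ => ?_
        beta_reduce
        rw [if_neg, mul_zero]
        rw [typeCount_cons, add_single_eq_iff]
        exact fun h => h.1 hc
      · rw [if_neg hc]
        simp only [typeCount_cons, add_single_eq_iff, ne_eq, hc, not_false_eq_true, true_and]
        rw [ih]
        refine if_congr ?_ rfl rfl
        have := sum_sub_single hc
        omega
    rw [listMean_succ]
    simp only [h1]
    by_cases hd : ∑ i, d i = m + 1
    · simp only [hd, if_true]
      rw [← multinomialProb_rec _ hd, Finset.sum_product_right]
      exact Finset.sum_congr rfl fun k _ => by rw [Finset.sum_mul]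
    · simp [hd]

theorem listMean_typeCount (hp : ∑ c ∈ V ×ˢ Finset.univ, p c = 1) (m : ℕ) (k : Fin N) :
    (listMean (V ×ˢ Finset.univ) p m fun l => (typeCount l k : ℝ)) = m * ∑ v ∈ V, p (v, k) := by
  induction m with
  | zero => simp [listMean_zero, typeCount]
  | succ m ih =>
    rw [listMean_succ]
    have h1 : ∀ c : α × Fin N, (listMean (V ×ˢ Finset.univ) p m fun l =>
        (typeCount (c :: l) k : ℝ)) = m * ∑ v ∈ V, p (v, k) + if c.2 = k then 1 else 0 := by
      intro c
      simp only [typeCount_cons, Pi.add_apply, Nat.cast_add]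
      rw [listMean_add, ih, listMean_const hp]
      congr 1
      by_cases hc : c.2 = k
      · simp [hc]
      · simp [hc, Ne.symm hc]
    simp only [h1, mul_add, Finset.sum_add_distrib]
    rw [← Finset.sum_mul, hp, Finset.sum_product]
    simp
    ring

end Types

/-! ### Degree identities and the one-step drift for a fixed graph. -/

section Graph

variable {α : Type} {N : ℕ}

/-- The edges `E` have no loops and have their endpoints in `V`. -/
def SupportedOn (V : Finset α) (E : EdgeSet α N) : Prop :=
  ∀ x ∈ E, ¬ x.1.IsDiag ∧ ∀ v ∈ x.1, v ∈ V

/-- The edges `E` together with an edge of type `k` from `v` to `w` for every `(w, k)` in `l`. -/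
def attach (E : EdgeSet α N) (v : α) (l : List (α × Fin N)) : EdgeSet α N :=
  E + Multiset.ofList (l.map fun c => (s(v, c.1), c.2))

theorem card_attach (E : EdgeSet α N) (v : α) (l : List (α × Fin N)) :
    Multiset.card (attach E v l) = Multiset.card E + l.length := by
  simp [attach]

theorem edgeCount_attach (E : EdgeSet α N) (v : α) (l : List (α × Fin N)) (k : Fin N) :
    edgeCount (attach E v l) k = edgeCount E k + typeCount l k := by
  simp only [edgeCount, attach, Multiset.countP_add, Multiset.coe_countP, List.countP_map, typeCount]
  rfl

theorem edgeCount_le_card (E : EdgeSet α N) (k : Fin N) : edgeCount E k ≤ Multiset.card E :=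
  Multiset.countP_le_card _ _

theorem sum_edgeCount (E : EdgeSet α N) : ∑ k, edgeCount E k = Multiset.card E := by
  induction E using Multiset.induction with
  | empty => simp [edgeCount]
  | cons x E ih =>
    simp only [edgeCount, Multiset.countP_cons, Finset.sum_add_distrib, Multiset.card_cons] at ih ⊢
    rw [ih]
    simp

variable [DecidableEq α] {V : Finset α} {E : EdgeSet α N}

theorem typeDegree_attach_of_ne (E : EdgeSet α N) {v w : α} (h : w ≠ v)
    (l : List (α × Fin N)) :
    typeDegree (attach E v l) w = typeDegree E w + fun k => l.count (w, k) := by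
  ext k
  simp only [typeDegree, attach, Multiset.countP_add, Multiset.coe_countP, List.countP_map,
    Pi.add_apply, List.count]
  congr 1
  refine List.countP_congr fun c _ => ?_
  simp only [Function.comp_apply, Sym2.mem_iff, h, false_or, decide_eq_true_eq, beq_iff_eq,
    Prod.ext_iff]
  rw [eq_comm (a := w)]

theorem typeDegree_attach_self (hE : SupportedOn V E) {v : α} (h : v ∉ V)
    (l : List (α × Fin N)) : typeDegree (attach E v l) v = typeCount l := by
  ext k
  have h1 : E.countP (fun e => v ∈ e.1 ∧ e.2 = k) = 0 :=
    Multiset.countP_eq_zero.2 fun x hx hv => h ((hE x hx).2 v hv.1)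
  simp only [typeDegree, attach, Multiset.countP_add, Multiset.coe_countP, List.countP_map,
    typeCount, h1, zero_add]
  refine List.countP_congr fun c _ => ?_
  simp

theorem supportedOn_attach (hE : SupportedOn V E) {v : α} (h : v ∉ V) {l : List (α × Fin N)}
    (hl : ∀ c ∈ l, c.1 ∈ V) : SupportedOn (insert v V) (attach E v l) := by
  intro x hx
  simp only [attach, Multiset.mem_add, Multiset.mem_coe, List.mem_map] at hx
  rcases hx with hx | ⟨c, hc, rfl⟩
  · exact ⟨(hE x hx).1, fun w hw => Finset.mem_insert_of_mem ((hE x hx).2 w hw)⟩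
  · constructor
    · simp only [Sym2.mk_isDiag_iff]
      rintro rfl
      exact h (hl c hc)
    · intro w hw
      rcases Sym2.mem_iff.1 hw with rfl | rfl
      · exact Finset.mem_insert_self _ _
      · exact Finset.mem_insert_of_mem (hl c hc)

theorem sum_typeDegree_eq_degree (E : EdgeSet α N) (v : α) :
    ∑ k, typeDegree E v k = degree E v := by
  induction E using Multiset.induction with
  | empty => simp [typeDegree, degree]
  | cons x E ih =>
    simp only [typeDegree, degree, Multiset.countP_cons, Finset.sum_add_distrib] at ih ⊢
    rw [ih]
    congr 1
    by_cases hv : v ∈ x.1 <;> simp [hv]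

theorem card_filter_mem_sym2 {x : Sym2 α} (hx : ¬ x.IsDiag) (hV : ∀ v ∈ x, v ∈ V) :
    (V.filter fun v => v ∈ x).card = 2 := by
  induction x using Sym2.ind with
  | _ a b =>
    have hab : a ≠ b := by simpa using hx
    rw [← Finset.card_pair hab]
    congr 1
    ext v
    simp only [Finset.mem_filter, Sym2.mem_iff, Finset.mem_insert, Finset.mem_singleton,
      and_iff_right_iff_imp]
    rintro (rfl | rfl)
    · exact hV _ (Sym2.mem_mk_left _ _)
    · exact hV _ (Sym2.mem_mk_right _ _)

/-- Handshake identity within one type; without loops every edge has exactly two endpoints. -/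
theorem sum_typeDegree_eq_edgeCount (hE : SupportedOn V E) (k : Fin N) :
    ∑ v ∈ V, typeDegree E v k = 2 * edgeCount E k := by
  induction E using Multiset.induction with
  | empty => simp [typeDegree, edgeCount]
  | cons x E ih =>
    have hx := hE x (Multiset.mem_cons_self x E)
    have ih' := ih fun y hy => hE y (Multiset.mem_cons_of_mem hy)
    simp only [typeDegree, edgeCount, Multiset.countP_cons, Finset.sum_add_distrib] at ih' ⊢
    rw [ih', mul_add]
    congr 1
    by_cases hk : x.2 = k
    · simp only [hk, and_true, if_true, mul_one]
      rw [← card_filter_mem_sym2 hx.1 hx.2, Finset.card_filter]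
    · simp [hk]

theorem sum_degree (hE : SupportedOn V E) : ∑ v ∈ V, degree E v = 2 * Multiset.card E := by
  simp only [← sum_typeDegree_eq_degree]
  rw [Finset.sum_comm, ← sum_edgeCount, Finset.mul_sum]
  exact Finset.sum_congr rfl fun k _ => sum_typeDegree_eq_edgeCount hE k

/-- The conditional probability that a new edge ends in `c.1` and has type `c.2`. -/
noncomputable def edgeProb (V : Finset α) (E : EdgeSet α N) (c : α × Fin N) : ℝ :=
  endpointProb V E c.1 * typeProb E c.1 c.2

/-- The degree of `v` cancels between the two choices. For degree `0` the convention `0 / 0 = 0`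
agrees with the vanishing type degree. -/
theorem edgeProb_eq (hE : SupportedOn V E) {v : α} (hv : v ∈ V) (k : Fin N) :
    edgeProb V E (v, k) = typeDegree E v k / (2 * Multiset.card E) := by
  have h1 : ∑ v ∈ V, (degree E v : ℝ) = 2 * Multiset.card E := by exact_mod_cast sum_degree hE
  simp only [edgeProb, endpointProb, typeProb, if_pos hv, h1]
  by_cases hd : degree E v = 0
  · have h2 : typeDegree E v k = 0 := by
      rw [← sum_typeDegree_eq_degree] at hd
      exact Finset.sum_eq_zero_iff.1 hd k (Finset.mem_univ k)
    simp [hd, h2]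
  · have h2 : (degree E v : ℝ) ≠ 0 := by exact_mod_cast hd
    field_simp

theorem edgeProb_nonneg (hE : SupportedOn V E) :
    ∀ c ∈ V ×ˢ (Finset.univ : Finset (Fin N)), 0 ≤ edgeProb V E c := by
  rintro ⟨v, k⟩ hc
  rw [edgeProb_eq hE (Finset.mem_product.1 hc).1]
  positivity

theorem sum_edgeProb_type (hE : SupportedOn V E) (k : Fin N) :
    ∑ v ∈ V, edgeProb V E (v, k) = edgeCount E k / Multiset.card E := by
  rw [Finset.sum_congr rfl fun v hv => edgeProb_eq hE hv k, ← Finset.sum_div]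
  have h1 : ∑ v ∈ V, (typeDegree E v k : ℝ) = 2 * edgeCount E k := by
    exact_mod_cast sum_typeDegree_eq_edgeCount hE k
  rw [h1, mul_div_mul_left _ _ two_ne_zero]

theorem sum_edgeProb_endpoint (hE : SupportedOn V E) {v : α} (hv : v ∈ V) :
    ∑ k, edgeProb V E (v, k) = degree E v / (2 * Multiset.card E) := by
  rw [Finset.sum_congr rfl fun k _ => edgeProb_eq hE hv k, ← Finset.sum_div,
    ← sum_typeDegree_eq_degree]
  push_cast
  rfl

theorem sum_edgeProb (hE : SupportedOn V E) (h0 : E ≠ 0) :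
    ∑ c ∈ V ×ˢ Finset.univ, edgeProb V E c = 1 := by
  have h1 : (Multiset.card E : ℝ) ≠ 0 := by simpa using h0
  rw [Finset.sum_product_right, Finset.sum_congr rfl fun k _ => sum_edgeProb_type hE k,
    ← Finset.sum_div, div_eq_one_iff_eq h1, ← sum_edgeCount]
  push_cast
  rfl

/-- The Pólya urn identity `(e + m e / S) / (S + m) = e / S`, for any fixed number `m` of new edges.
-/
theorem listMean_edgeCount_div (hE : SupportedOn V E) (h0 : E ≠ 0) (v : α) (m : ℕ) (k : Fin N) :
    (listMean (V ×ˢ Finset.univ) (edgeProb V E) m fun l =>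
      (edgeCount (attach E v l) k : ℝ) / (Multiset.card (attach E v l) : ℝ)) =
    edgeCount E k / Multiset.card E := by
  have h1 : 0 < (Multiset.card E : ℝ) := by
    exact_mod_cast Multiset.card_pos.2 h0
  have h2 : (listMean (V ×ˢ Finset.univ) (edgeProb V E) m fun l =>
      (edgeCount (attach E v l) k : ℝ) / (Multiset.card (attach E v l) : ℝ)) =
      listMean (V ×ˢ Finset.univ) (edgeProb V E) m fun l =>
        ((edgeCount E k : ℝ) + typeCount l k) * (Multiset.card E + m : ℝ)⁻¹ := by
    refine listMean_congr fun l hl => ?_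
    rw [edgeCount_attach, card_attach, hl, div_eq_mul_inv]
    push_cast
    rfl
  rw [h2, listMean_mul_const, listMean_add, listMean_const (sum_edgeProb hE h0),
    listMean_typeCount (sum_edgeProb hE h0), sum_edgeProb_type hE]
  have h3 : (Multiset.card E + m : ℝ) ≠ 0 := by positivity
  field_simp

theorem numWithDegree_eq_sum (V : Finset α) (E : EdgeSet α N) (d : Fin N → ℕ) :
    (numWithDegree V E d : ℝ) = ∑ w ∈ V, if typeDegree E w = d then (1 : ℝ) else 0 := by
  simp [numWithDegree]

theorem numWithDegree_attach_sub {v : α} (h : v ∉ V) (l : List (α × Fin N)) (d : Fin N → ℕ) :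
    (numWithDegree (insert v V) (attach E v l) d : ℝ) - numWithDegree V E d =
      (if typeDegree (attach E v l) v = d then 1 else 0) +
      ∑ w ∈ V, ((if (typeDegree E w + fun k => l.count (w, k)) = d then 1 else 0) -
        if typeDegree E w = d then 1 else 0) := by
  rw [numWithDegree_eq_sum, numWithDegree_eq_sum, Finset.sum_insert h, Finset.sum_sub_distrib,
    add_sub_assoc]
  congr 2
  refine Finset.sum_congr rfl fun w hw => ?_
  rw [typeDegree_attach_of_ne]
  rintro rfl
  exact h hw

theorem sum_countP_le_length (V : Finset α) (l : List (α × Fin N)) :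
    ∑ w ∈ V, l.countP (fun c => c.1 = w) ≤ l.length := by
  induction l with
  | nil => simp
  | cons c l ih =>
    simp only [List.countP_cons, Finset.sum_add_distrib, List.length_cons, decide_eq_true_eq,
      Finset.sum_ite_eq]
    split_ifs <;> omega

/-- Besides the new vertex, only endpoints of new edges can change their degree vector. -/
theorem abs_numWithDegree_attach_sub_le {v : α} (h : v ∉ V) (l : List (α × Fin N))
    (d : Fin N → ℕ) :
    |(numWithDegree (insert v V) (attach E v l) d : ℝ) - numWithDegree V E d| ≤ 1 + l.length := by
  rw [numWithDegree_attach_sub h]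
  refine (abs_add_le _ _).trans (add_le_add (by split_ifs <;> simp) ?_)
  have h1 : ∑ w ∈ V, (l.countP (fun c => c.1 = w) : ℝ) ≤ l.length := by
    exact_mod_cast sum_countP_le_length V l
  refine (Finset.abs_sum_le_sum_abs _ _).trans ((Finset.sum_le_sum fun w _ => ?_).trans h1)
  by_cases hc : l.countP (fun c => c.1 = w) = 0
  · have h2 : (fun k => l.count (w, k)) = (0 : Fin N → ℕ) := by
      ext k
      refine List.count_eq_zero.2 fun hk => ?_
      simpa using List.countP_eq_zero.1 hc _ hk
    simp [h2]
  · have h2 : (1 : ℝ) ≤ (l.countP (fun c => c.1 = w) : ℝ) := by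
      exact_mod_cast Nat.one_le_iff_ne_zero.2 hc
    refine le_trans ?_ h2
    split_ifs <;> simp

/-- The contribution of an old vertex to the expected increment, per new edge. -/
noncomputable def driftPerEdge (V : Finset α) (E : EdgeSet α N) (d : Fin N → ℕ) : ℝ :=
  (∑ k, (if d k = 0 then 0 else ((d k : ℝ) - 1) * numWithDegree V E (d - Pi.single k 1)) -
    (∑ k, d k : ℕ) * numWithDegree V E d) / (2 * Multiset.card E)

theorem sum_edgeProb_mul_sub (hE : SupportedOn V E) (d : Fin N → ℕ) :
    ∑ w ∈ V, ∑ k, edgeProb V E (w, k) * ((if typeDegree E w + Pi.single k 1 = d then 1 else 0) -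
      if typeDegree E w = d then 1 else 0) = driftPerEdge V E d := by
  have hterm : ∀ w ∈ V, ∀ k, edgeProb V E (w, k) *
      ((if typeDegree E w + Pi.single k 1 = d then 1 else 0) -
      if typeDegree E w = d then 1 else 0) =
      ((if d k = 0 then 0 else ((d k : ℝ) - 1) *
        (if typeDegree E w = d - Pi.single k 1 then 1 else 0)) -
        d k * (if typeDegree E w = d then 1 else 0)) / (2 * Multiset.card E) := by
    intro w hw k
    rw [edgeProb_eq hE hw, div_mul_eq_mul_div, mul_sub]
    congr 2
    · by_cases hk : d k = 0
      · rw [if_pos hk, if_neg, mul_zero]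
        rw [add_single_eq_iff]
        exact fun h => h.1 hk
      · rw [if_neg hk]
        by_cases h : typeDegree E w = d - Pi.single k 1
        · rw [if_pos h, if_pos (add_single_eq_iff.2 ⟨hk, h⟩), h]
          -- A vertex of degree `d - e_k` has `d k - 1` edges of type `k`; this is the source of the
          -- coefficient.
          simp [Nat.cast_sub (Nat.one_le_iff_ne_zero.2 hk)]
        · rw [if_neg h, if_neg, mul_zero, mul_zero]
          rw [add_single_eq_iff]
          exact fun h' => h h'.2
    · by_cases h : typeDegree E w = d
      · rw [h]
      · simp [h]
  rw [Finset.sum_congr rfl fun w hw => Finset.sum_congr rfl fun k _ => hterm w hw k]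
  simp only [← Finset.sum_div]
  rw [driftPerEdge, Finset.sum_comm]
  simp only [Finset.sum_sub_distrib, ← Finset.mul_sum]
  congr 2
  · refine Finset.sum_congr rfl fun k _ => ?_
    split_ifs with hk
    · simp
    · rw [numWithDegree_eq_sum, Finset.mul_sum]
  · rw [← Finset.sum_mul, numWithDegree_eq_sum]
    push_cast
    rfl

/-- By `sum_edgeProb_mul_sub` the drift is an average of numbers in `[-1, 1]`. -/
theorem abs_driftPerEdge_le (hE : SupportedOn V E) (h0 : E ≠ 0) (d : Fin N → ℕ) :
    |driftPerEdge V E d| ≤ 1 := by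
  rw [← sum_edgeProb_mul_sub hE]
  refine le_trans ?_ ((Finset.sum_product _ _ _).symm.trans (sum_edgeProb hE h0)).le
  refine (Finset.abs_sum_le_sum_abs _ _).trans (Finset.sum_le_sum fun w hw => ?_)
  refine (Finset.abs_sum_le_sum_abs _ _).trans (Finset.sum_le_sum fun k _ => ?_)
  have h1 := edgeProb_nonneg hE (w, k) (by simp [hw])
  rw [abs_mul, abs_of_nonneg h1]
  refine mul_le_of_le_one_right h1 ?_
  split_ifs <;> simp

/-- The hitting probabilities add up to `1`, and each one retained is at most `D / (2 |E|)`. -/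
theorem sum_sq_edgeProb_le (hE : SupportedOn V E) (h0 : E ≠ 0) (D : ℕ) :
    ∑ w ∈ V, (if degree E w ≤ D then (∑ k, edgeProb V E (w, k)) ^ 2 else 0) ≤
      D / (2 * Multiset.card E) := by
  have h1 : ∑ w ∈ V, (∑ k, edgeProb V E (w, k)) * (D / (2 * Multiset.card E) : ℝ) =
      D / (2 * Multiset.card E) := by
    rw [← Finset.sum_mul, ← Finset.sum_product' V Finset.univ fun w k => edgeProb V E (w, k)]
    have := sum_edgeProb hE h0
    simp only [Prod.mk.eta, this, one_mul]
  refine le_trans (Finset.sum_le_sum fun w hw => ?_) h1.le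
  rw [sum_edgeProb_endpoint hE hw]
  split_ifs with h
  · rw [sq]
    gcongr
  · positivity

/-- The new vertex contributes the multinomial term exactly. Each old vertex is linearized by
`abs_hitProb_sub_linear_le`, and the quadratic errors are summed by `sum_sq_edgeProb_le`. -/
theorem abs_listMean_increment_sub_le (hE : SupportedOn V E) (h0 : E ≠ 0) {v : α} (hv : v ∉ V)
    (d : Fin N → ℕ) (m : ℕ) :
    |(listMean (V ×ˢ Finset.univ) (edgeProb V E) m fun l =>
        (numWithDegree (insert v V) (attach E v l) d : ℝ) - numWithDegree V E d) -
      (m * driftPerEdge V E d + (if m = ∑ k, d k then 1 else 0) *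
        multinomialProb (fun k => (edgeCount E k : ℝ) / Multiset.card E) d)| ≤
      m ^ 2 * ((∑ k, d k : ℕ) / (2 * Multiset.card E)) := by
  have hp := sum_edgeProb hE h0
  have hp0 := edgeProb_nonneg hE
  have h1 : (listMean (V ×ˢ Finset.univ) (edgeProb V E) m fun l =>
        (numWithDegree (insert v V) (attach E v l) d : ℝ) - numWithDegree V E d) =
      (if m = ∑ k, d k then 1 else 0) *
        multinomialProb (fun k => (edgeCount E k : ℝ) / Multiset.card E) d +
      ∑ w ∈ V, (hitProb V (edgeProb V E) w d m (typeDegree E w) -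
        hitProb V (edgeProb V E) w d 0 (typeDegree E w)) := by
    simp only [numWithDegree_attach_sub hv, typeDegree_attach_self hE hv]
    rw [listMean_add, listMean_typeCount_eq, listMean_sum]
    simp only [listMean_sub, listMean_const hp, sum_edgeProb_type hE, hitProb_zero, ite_mul,
      one_mul, zero_mul, eq_comm (a := m)]
    rfl
  rw [h1, ← sum_edgeProb_mul_sub hE, Finset.mul_sum]
  have h2 : ∀ w ∈ V, |hitProb V (edgeProb V E) w d m (typeDegree E w) -
        hitProb V (edgeProb V E) w d 0 (typeDegree E w) - m * ∑ k, edgeProb V E (w, k) *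
        ((if typeDegree E w + Pi.single k 1 = d then 1 else 0) -
          if typeDegree E w = d then 1 else 0)| ≤
      m ^ 2 * if degree E w ≤ ∑ k, d k then (∑ k, edgeProb V E (w, k)) ^ 2 else 0 := by
    intro w hw
    simp only [← hitProb_zero (V := V) (p := edgeProb V E) w]
    split_ifs with hd
    · exact abs_hitProb_sub_linear_le hp hp0 hw d m _
    · rw [← sum_typeDegree_eq_degree, not_le] at hd
      have h3 : ∀ k, hitProb V (edgeProb V E) w d 0 (typeDegree E w + Pi.single k 1) = 0 :=
        fun k => hitProb_eq_zero (by
          simp only [Pi.add_apply, Finset.sum_add_distrib]; omega) 0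
      simp [h3, hitProb_eq_zero hd]
  refine le_trans (le_of_eq ?_) (le_trans (Finset.abs_sum_le_sum_abs (fun w =>
    hitProb V (edgeProb V E) w d m (typeDegree E w) -
        hitProb V (edgeProb V E) w d 0 (typeDegree E w) - m * ∑ k, edgeProb V E (w, k) *
        ((if typeDegree E w + Pi.single k 1 = d then 1 else 0) -
          if typeDegree E w = d then 1 else 0)) V) ?_)
  · have key : ∀ (a : ℝ) (f g : α → ℝ), a + ∑ w ∈ V, f w - (∑ w ∈ V, g w + a) =
        ∑ w ∈ V, (f w - g w) := by
      intro a f g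
      rw [Finset.sum_sub_distrib]
      ring
    exact congrArg abs (key _ _ _)
  · refine (Finset.sum_le_sum h2).trans ?_
    rw [← Finset.mul_sum]
    exact mul_le_mul_of_nonneg_left (sum_sq_edgeProb_le hE h0 _) (by positivity)

end Graph

/-! ### Measurability on countable graph spaces and the conditional law of a step. -/

theorem measurableSet_of_countable_of_forall_fiber {Ω β : Type*} [Countable β]
    {m0 : MeasurableSpace Ω} {f : Ω → β} (hf : ∀ b, MeasurableSet {ω | f ω = b}) :
    Measurable[m0, ⊤] f :=
  @measurable_to_countable' β Ω ⊤ _ m0 f hf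

section Vertices

theorem vertexSet_succ (s n : ℕ) :
    vertexSet s (n + 1) = insert (Sum.inr (n + 1)) (vertexSet s n) := by
  ext v
  rcases v with v | v
  · simp [vertexSet]
  · simp only [vertexSet, Finset.inr_mem_disjSum, Finset.mem_Icc, Finset.mem_insert, Sum.inr.injEq]
    omega

theorem inr_succ_notMem_vertexSet (s n : ℕ) : Sum.inr (n + 1) ∉ vertexSet s n := by
  simp [vertexSet]

theorem card_vertexSet (s n : ℕ) : (vertexSet s n).card = s + n := by
  simp [vertexSet]

end Vertices

instance (s N : ℕ) : Countable (EdgeSet (Vertex s) N) := by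
  unfold EdgeSet Multiset Sym2
  infer_instance

section Measurability

variable {Ω : Type*} {m0 : MeasurableSpace Ω} {s N : ℕ} {E₀ : EdgeSet (Fin s) N}
  {M : ℕ → Ω → ℕ} {C : ℕ → Ω → List (Vertex s × Fin N)}

theorem edges_succ (n : ℕ) (ω : Ω) :
    edges E₀ C (n + 1) ω = attach (edges E₀ C n ω) (Sum.inr (n + 1)) (C (n + 1) ω) := rfl

theorem measurable_edges {P : Measure Ω} (hG : IsGenBA P E₀ M C) (n : ℕ) :
    Measurable[m0, ⊤] (edges E₀ C n) := by
  induction n with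
  | zero => exact @measurable_const _ _ ⊤ m0 _
  | succ n ih =>
    have hC : Measurable[m0, ⊤] (C (n + 1)) :=
      measurableSet_of_countable_of_forall_fiber fun l => hG.measurable_C n l
    have hpair : Measurable[m0, ⊤] fun ω => (edges E₀ C n ω, C (n + 1) ω) := by
      refine measurableSet_of_countable_of_forall_fiber fun q => ?_
      have : {ω | (edges E₀ C n ω, C (n + 1) ω) = q} =
          edges E₀ C n ⁻¹' {q.1} ∩ C (n + 1) ⁻¹' {q.2} := by
        ext ω
        simp [Prod.ext_iff]
      rw [this]
      exact (ih trivial).inter (hC trivial)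
    exact fun t _ => hpair (t := {q | attach q.1 (Sum.inr (n + 1)) q.2 ∈ t}) trivial

theorem measurable_history_edges (n : ℕ) :
    Measurable[history E₀ C n, ⊤] (edges E₀ C n) := by
  rcases Nat.eq_zero_or_pos n with rfl | hn
  · exact @measurable_const _ _ ⊤ _ _
  · refine Measurable.mono (comap_measurable (edges E₀ C n)) ?_ le_rfl
    exact le_iSup₂_of_le n (Finset.mem_Icc.2 ⟨hn, le_rfl⟩) le_rfl

theorem measurable_history_comp {β : Type*} [MeasurableSpace β] (n : ℕ)
    (g : EdgeSet (Vertex s) N → β) :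
    Measurable[history E₀ C n] fun ω => g (edges E₀ C n ω) :=
  fun t _ => measurable_history_edges n (t := g ⁻¹' t) trivial

/-- The filtration `ℱₙ`. -/
def historyFiltration {P : Measure Ω} (hG : IsGenBA P E₀ M C) : Filtration ℕ m0 where
  seq := history E₀ C
  mono' := fun i j hij => iSup₂_le fun k hk => le_iSup₂_of_le k (by
    rw [Finset.mem_Icc] at hk ⊢
    exact ⟨hk.1, hk.2.trans hij⟩) le_rfl
  le' := fun _ => iSup₂_le fun k _ => (measurable_edges hG k).comap_le

theorem history_le {P : Measure Ω} (hG : IsGenBA P E₀ M C) (n : ℕ) : history E₀ C n ≤ m0 :=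
  (historyFiltration hG).le n

theorem history_le_historyPlus (n : ℕ) : history E₀ C n ≤ historyPlus E₀ C M n := le_sup_left

theorem historyPlus_le {P : Measure Ω} (hG : IsGenBA P E₀ M C) (n : ℕ) :
    historyPlus E₀ C M n ≤ m0 :=
  sup_le (history_le hG n) (hG.measurable_M n).comap_le

/-- A list with an endpoint outside the current vertex set has conditional probability `0`, and
there are only countably many lists. -/
theorem ae_forall_mem_vertexSet {P : Measure Ω} [IsProbabilityMeasure P]
    (hG : IsGenBA P E₀ M C) :
    ∀ᵐ ω ∂P, ∀ n, ∀ c ∈ C (n + 1) ω, c.1 ∈ vertexSet s n := by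
  have h1 : ∀ n, ∀ l : List (Vertex s × Fin N), ∀ᵐ ω ∂P,
      (∃ c ∈ l, c.1 ∉ vertexSet s n) → C (n + 1) ω ≠ l := by
    intro n l
    by_cases hl : ∃ c ∈ l, c.1 ∉ vertexSet s n
    · obtain ⟨c, hc, hcV⟩ := hl
      have h2 : P⟦{ω | C (n + 1) ω = l} | historyPlus E₀ C M n⟧ =ᵐ[P] 0 := by
        refine (hG.condProb_C n l).trans (Eventually.of_forall fun ω => ?_)
        have h3 : (l.map (fun c => endpointProb (vertexSet s n) (edges E₀ C n ω) c.1 *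
          typeProb (edges E₀ C n ω) c.1 c.2)).prod = 0 :=
          List.prod_eq_zero (List.mem_map.2 ⟨c, hc, by simp [endpointProb, hcV]⟩)
        simp [h3]
      have h4 := integral_condExp (μ := P) (historyPlus_le hG n)
        (f := {ω | C (n + 1) ω = l}.indicator fun _ => (1 : ℝ))
      rw [integral_congr_ae h2, integral_indicator_const _ (hG.measurable_C n l)] at h4
      have h5 : P {ω | C (n + 1) ω = l} = 0 := by
        simpa [measureReal_eq_zero_iff] using h4.symm
      have h6 : ∀ᵐ ω ∂P, C (n + 1) ω ≠ l := by
        rw [ae_iff]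
        simpa using h5
      filter_upwards [h6] with ω hω _ using hω
    · exact Eventually.of_forall fun ω h => absurd h hl
  have h2 := ae_all_iff.2 fun n => ae_all_iff.2 (h1 n)
  filter_upwards [h2] with ω hω n c hc
  by_contra hcV
  exact hω n (C (n + 1) ω) ⟨c, hc, hcV⟩ rfl

theorem ae_supportedOn {P : Measure Ω} [IsProbabilityMeasure P]
    (hE₀ : IsInitial E₀) (hG : IsGenBA P E₀ M C) :
    ∀ᵐ ω ∂P, ∀ n, SupportedOn (vertexSet s n) (edges E₀ C n ω) := by
  filter_upwards [ae_forall_mem_vertexSet hG] with ω hω n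
  induction n with
  | zero =>
    intro x hx
    simp only [edges, Multiset.mem_map] at hx
    obtain ⟨e, he, rfl⟩ := hx
    refine ⟨?_, fun v hv => ?_⟩
    · rw [Sym2.isDiag_map Sum.inl_injective]
      exact hE₀.loopless e he
    · obtain ⟨u, _, rfl⟩ := Sym2.mem_map.1 hv
      simp [vertexSet]
  | succ n ih =>
    rw [edges_succ, vertexSet_succ]
    exact supportedOn_attach ih (inr_succ_notMem_vertexSet s n) (hω n)

theorem card_edges_succ {P : Measure Ω} (hG : IsGenBA P E₀ M C) (n : ℕ) (ω : Ω) :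
    Multiset.card (edges E₀ C (n + 1) ω) = Multiset.card (edges E₀ C n ω) + M (n + 1) ω := by
  rw [edges_succ, card_attach, hG.length_C]

theorem edges_ne_zero (hE₀ : E₀ ≠ 0) (n : ℕ) (ω : Ω) : edges E₀ C n ω ≠ 0 := by
  rw [← Multiset.card_pos]
  induction n with
  | zero =>
    simp only [edges, Multiset.card_map]
    exact Multiset.card_pos.2 hE₀
  | succ n ih =>
    rw [edges_succ, card_attach]
    omega

/-- Extends `condProb_C` from single lists to arbitrary integrable functions. The space splits into
countably many events with `G_n` and `M_{n+1}` fixed; on each, the function is almost surely a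
finite combination of indicators of lists. -/
theorem condExp_historyPlus {P : Measure Ω} [IsProbabilityMeasure P] (hG : IsGenBA P E₀ M C)
    (n : ℕ) (g : EdgeSet (Vertex s) N → List (Vertex s × Fin N) → ℝ)
    (hg : Integrable (fun ω => g (edges E₀ C n ω) (C (n + 1) ω)) P) :
    P[fun ω => g (edges E₀ C n ω) (C (n + 1) ω) | historyPlus E₀ C M n] =ᵐ[P] fun ω =>
      listMean (vertexSet s n ×ˢ Finset.univ) (edgeProb (vertexSet s n) (edges E₀ C n ω))
        (M (n + 1) ω) (g (edges E₀ C n ω)) := by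
  set A : Finset (Vertex s × Fin N) := vertexSet s n ×ˢ Finset.univ with hA
  have hatom : ∀ e m, MeasurableSet[historyPlus E₀ C M n] {ω | edges E₀ C n ω = e ∧ M (n + 1) ω = m} := by
    intro e m
    refine MeasurableSet.inter (m := historyPlus E₀ C M n) (s₁ := {ω | edges E₀ C n ω = e})
      (s₂ := {ω | M (n + 1) ω = m}) ?_ ?_
    · exact history_le_historyPlus n _ (measurable_history_edges n (t := {e}) trivial)
    · exact (le_sup_right : _ ≤ historyPlus E₀ C M n) _ ⟨{m}, trivial, rfl⟩
  have key : ∀ e m, ∀ᵐ ω ∂P, edges E₀ C n ω = e ∧ M (n + 1) ω = m →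
      (P[fun ω => g (edges E₀ C n ω) (C (n + 1) ω) | historyPlus E₀ C M n]) ω =
        listMean A (edgeProb (vertexSet s n) e) m (g e) := by
    intro e m
    set S : Set Ω := {ω | edges E₀ C n ω = e ∧ M (n + 1) ω = m} with hS
    set F : Ω → ℝ := ∑ l ∈ listsOfLength A m,
      g e l • {ω | C (n + 1) ω = l}.indicator fun _ => (1 : ℝ) with hF
    have hind : ∀ l, Integrable ({ω | C (n + 1) ω = l}.indicator fun _ => (1 : ℝ)) P :=
      fun l => (integrable_const 1).indicator (hG.measurable_C n l)
    have hFint : Integrable F P := integrable_finsetSum' _ fun l _ => (hind l).smul (g e l)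
    have h1 : S.indicator (fun ω => g (edges E₀ C n ω) (C (n + 1) ω)) =ᵐ[P] S.indicator F := by
      filter_upwards [ae_forall_mem_vertexSet hG] with ω hω
      by_cases hωS : ω ∈ S
      · rw [Set.indicator_of_mem hωS, Set.indicator_of_mem hωS, hωS.1]
        have h2 : C (n + 1) ω ∈ listsOfLength A m :=
          mem_listsOfLength.2 ⟨(hG.length_C n ω).trans hωS.2, fun c hc => by
            simp [hA, hω n c hc]⟩
        simp only [hF, Finset.sum_apply, Pi.smul_apply, smul_eq_mul]
        rw [Finset.sum_eq_single_of_mem _ h2]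
        · simp
        · intro l _ hl
          simp [Ne.symm hl]
      · rw [Set.indicator_of_notMem hωS, Set.indicator_of_notMem hωS]
    have h2 := condExp_indicator (m := historyPlus E₀ C M n) hg (hatom e m)
    have h3 := condExp_indicator (m := historyPlus E₀ C M n) hFint (hatom e m)
    have h4 := condExp_congr_ae (m := historyPlus E₀ C M n) h1
    have h5 : P[F | historyPlus E₀ C M n] =ᵐ[P] ∑ l ∈ listsOfLength A m,
        P[g e l • {ω | C (n + 1) ω = l}.indicator fun _ => (1 : ℝ) | historyPlus E₀ C M n] :=
      condExp_finsetSum (fun l _ => (hind l).smul (g e l)) _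
    have h6 : ∀ᵐ ω ∂P, ∀ l, (P[g e l • {ω | C (n + 1) ω = l}.indicator fun _ => (1 : ℝ) | historyPlus E₀ C M n]) ω =
        g e l * (if M (n + 1) ω = l.length then
          (l.map (edgeProb (vertexSet s n) (edges E₀ C n ω))).prod else 0) := by
      refine ae_all_iff.2 fun l => ?_
      filter_upwards [condExp_smul (μ := P) (g e l)
        ({ω | C (n + 1) ω = l}.indicator fun _ => (1 : ℝ)) _, hG.condProb_C n l] with ω hω1 hω2
      rw [hω1, Pi.smul_apply, hω2, smul_eq_mul]
      rfl
    filter_upwards [h2, h3, h4, h5, h6] with ω hω2 hω3 hω4 hω5 hω6 hωS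
    have hωS' : ω ∈ S := hωS
    rw [hω2, hω3, Set.indicator_of_mem hωS', Set.indicator_of_mem hωS', hω5] at hω4
    rw [hω4, Finset.sum_apply, listMean]
    refine Finset.sum_congr rfl fun l hl => ?_
    rw [hω6 l, hωS.1, hωS.2, if_pos (mem_listsOfLength.1 hl).1.symm, mul_comm]
  have key' := ae_all_iff.2 fun e => ae_all_iff.2 (key e)
  filter_upwards [key'] with ω hω
  exact hω _ _ ⟨rfl, rfl⟩

end Measurability

/-! ### Consequences of the assumptions on the numbers of edges. -/

section Moments

variable {Ω Ω' : Type*} [MeasurableSpace Ω] [MeasurableSpace Ω'] {P : Measure Ω}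
  [IsProbabilityMeasure P] {P' : Measure Ω'} [IsProbabilityMeasure P'] {M : ℕ → Ω → ℕ} {L : Ω' → ℝ}

/-- Convergence to a finite limit controls second moments only from some `n₀` on; early ones may be
infinite. -/
theorem BA2.exists_memLp_two (h : BA2 P P' M L) (hM : ∀ n, Measurable (M (n + 1))) :
    ∃ (n₀ : ℕ) (B : ℝ), ∀ n, n₀ ≤ n →
      MemLp (fun ω => (M (n + 1) ω : ℝ)) 2 P ∧ ∫ ω, (M (n + 1) ω : ℝ) ^ 2 ∂P ≤ B := by
  set b : ℝ≥0∞ := ∫⁻ ω, ENNReal.ofReal (L ω) ^ 2 ∂P' with hb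
  have hb1 : b + 1 ≠ ∞ := ENNReal.add_ne_top.2 ⟨(h.moment_lt_top 2 one_le_two).ne, ENNReal.one_ne_top⟩
  have h1 : ∀ᶠ n in atTop, ∫⁻ ω, (M (n + 1) ω : ℝ≥0∞) ^ 2 ∂P ≤ b + 1 :=
    (h.tendsto_moment 2 one_le_two).eventually_le_const
      (ENNReal.lt_add_right (h.moment_lt_top 2 one_le_two).ne one_ne_zero)
  obtain ⟨n₀, hn₀⟩ := eventually_atTop.1 h1
  refine ⟨n₀, (b + 1).toReal, fun n hn => ?_⟩
  have hmeas : Measurable fun ω => (M (n + 1) ω : ℝ) := measurable_from_top.comp (hM n)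
  have h2 : ∀ ω, ENNReal.ofReal ((M (n + 1) ω : ℝ) ^ 2) = (M (n + 1) ω : ℝ≥0∞) ^ 2 := by
    intro ω
    rw [ENNReal.ofReal_pow (Nat.cast_nonneg _), ENNReal.ofReal_natCast]
  constructor
  · rw [memLp_two_iff_integrable_sq hmeas.aestronglyMeasurable]
    refine ⟨(hmeas.pow_const 2).aestronglyMeasurable, ?_⟩
    rw [hasFiniteIntegral_iff_ofReal (Eventually.of_forall fun ω => by positivity)]
    simp only [h2]
    exact (hn₀ n hn).trans_lt hb1.lt_top
  · rw [integral_eq_lintegral_of_nonneg_ae (Eventually.of_forall fun ω => by positivity)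
      (hmeas.pow_const 2).aestronglyMeasurable]
    simp only [h2]
    exact ENNReal.toReal_mono hb1 (hn₀ n hn)

theorem BA2.exists_tendsto_mean (h : BA2 P P' M L) (hM : ∀ n, Measurable (M (n + 1)))
    (hpos : ∀ n, ∀ᵐ ω ∂P, 0 < M (n + 1) ω) :
    ∃ μ : ℝ, 1 ≤ μ ∧ Tendsto (fun n => ∫ ω, (M (n + 1) ω : ℝ) ∂P) atTop (𝓝 μ) := by
  have h1 := h.tendsto_moment 1 le_rfl
  have h2 := (h.moment_lt_top 1 le_rfl).ne
  simp only [pow_one] at h1 h2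
  refine ⟨(∫⁻ ω, ENNReal.ofReal (L ω) ∂P').toReal, ?_, ?_⟩
  · rw [← ENNReal.toReal_one]
    refine ENNReal.toReal_mono h2 (ge_of_tendsto' h1 fun n => ?_)
    calc (1 : ℝ≥0∞) = ∫⁻ _, 1 ∂P := by simp
      _ ≤ ∫⁻ ω, (M (n + 1) ω : ℝ≥0∞) ∂P := by
        refine lintegral_mono_ae ?_
        filter_upwards [hpos n] with ω hω
        exact_mod_cast hω
  · refine ((ENNReal.tendsto_toReal h2).comp h1).congr fun n => ?_
    have hmeas : Measurable fun ω => (M (n + 1) ω : ℝ) := measurable_from_top.comp (hM n)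
    rw [integral_eq_lintegral_of_nonneg_ae (Eventually.of_forall fun ω => by positivity)
      hmeas.aestronglyMeasurable]
    simp

/-- Since `M (n + 1)` is integer valued, `{M (n + 1) = D}` is the preimage both of the closed set
`{D}` and of the open interval `(D - 1, D + 1)`. The two halves of the portmanteau theorem then
squeeze its probability. -/
theorem BA2.tendsto_prob (h : BA2 P P' M L) (D : ℕ) :
    Tendsto (fun n => P.real {ω | M (n + 1) ω = D}) atTop (𝓝 (P'.real {ω' | L ω' = (D : ℝ)})) := by
  have hD := h.tendsto_distribution
  refine (ENNReal.tendsto_toReal (measure_ne_top P' _)).comp ?_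
  have hF : ∀ n, (P.map fun ω => (M (n + 1) ω : ℝ)) {(D : ℝ)} = P {ω | M (n + 1) ω = D} := by
    intro n
    rw [Measure.map_apply_of_aemeasurable (hD.forall_aemeasurable n) (measurableSet_singleton _)]
    congr 1
    ext ω
    simp
  have hG : ∀ n, (P.map fun ω => (M (n + 1) ω : ℝ)) (Set.Ioo ((D : ℝ) - 1) (D + 1)) =
      P {ω | M (n + 1) ω = D} := by
    intro n
    rw [Measure.map_apply_of_aemeasurable (hD.forall_aemeasurable n) measurableSet_Ioo]
    congr 1
    ext ω
    simp only [Set.mem_preimage, Set.mem_Ioo, Set.mem_ofPred_eq]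
    constructor
    · rintro ⟨h1, h2⟩
      have h3 : D < M (n + 1) ω + 1 := by exact_mod_cast (by linarith : (D : ℝ) < M (n + 1) ω + 1)
      have h4 : M (n + 1) ω < D + 1 := by exact_mod_cast h2
      omega
    · intro h1
      rw [h1]
      constructor <;> linarith
  have h1 := ProbabilityMeasure.limsup_measure_closed_le_of_tendsto hD.tendsto
    (isClosed_singleton (x := (D : ℝ)))
  have h2 := ProbabilityMeasure.le_liminf_measure_open_of_tendsto hD.tendsto
    (isOpen_Ioo (a := (D : ℝ) - 1) (b := D + 1))
  simp only [ProbabilityMeasure.coe_mk, hF, hG] at h1 h2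
  rw [Measure.map_apply_of_aemeasurable hD.aemeasurable_limit (measurableSet_singleton _)] at h1
  rw [Measure.map_apply_of_aemeasurable hD.aemeasurable_limit measurableSet_Ioo] at h2
  refine tendsto_of_le_liminf_of_limsup_le (le_trans (measure_mono ?_) h2) h1
  intro ω hω
  have hω' : L ω = D := hω
  simp [hω']

end Moments

/-! ### Conditional expectations given the history. -/

section Conditional

variable {Ω : Type*} {m0 : MeasurableSpace Ω} {P : Measure Ω}

theorem abs_condExp_sub_condExp_le {m : MeasurableSpace Ω} {f g k : Ω → ℝ} (hf : Integrable f P)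
    (hg : Integrable g P) (hk : Integrable k P) (h : ∀ᵐ ω ∂P, |f ω - g ω| ≤ k ω) :
    ∀ᵐ ω ∂P, |(P[f | m]) ω - (P[g | m]) ω| ≤ (P[k | m]) ω := by
  have h1 := abs_condExp_ae_le_condExp_abs (m := m) (μ := P) (f - g)
  have h2 := condExp_mono (m := m) (hf.sub hg).abs hk h
  filter_upwards [h1, h2, condExp_sub hf hg m] with ω hω1 hω2 hω3
  have h4 := hω1.trans hω2
  rw [Pi.abs_apply, hω3] at h4
  exact h4

variable {s N : ℕ} {E₀ : EdgeSet (Fin s) N} {M : ℕ → Ω → ℕ} {C : ℕ → Ω → List (Vertex s × Fin N)}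

/-- The increment of the number of vertices of generalized degree `d`. -/
noncomputable def increment (E₀ : EdgeSet (Fin s) N) (C : ℕ → Ω → List (Vertex s × Fin N))
    (d : Fin N → ℕ) (n : ℕ) (ω : Ω) : ℝ :=
  (numWithDegree (vertexSet s (n + 1)) (edges E₀ C (n + 1) ω) d : ℝ) -
    numWithDegree (vertexSet s n) (edges E₀ C n ω) d

theorem measurable_increment (hG : IsGenBA P E₀ M C) (d : Fin N → ℕ) (n : ℕ) :
    Measurable[history E₀ C (n + 1)] (increment E₀ C d n) := by
  refine Measurable.sub ?_ ?_
  · exact measurable_history_comp (n + 1) fun e => (numWithDegree (vertexSet s (n + 1)) e d : ℝ)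
  · exact (measurable_history_comp n fun e => (numWithDegree (vertexSet s n) e d : ℝ)).mono
      ((historyFiltration hG).mono (Nat.le_succ n)) le_rfl

theorem abs_increment_le (hG : IsGenBA P E₀ M C) (d : Fin N → ℕ) (n : ℕ) (ω : Ω) :
    |increment E₀ C d n ω| ≤ 1 + M (n + 1) ω := by
  rw [increment, vertexSet_succ, edges_succ, ← hG.length_C n ω]
  exact abs_numWithDegree_attach_sub_le (inr_succ_notMem_vertexSet s n) _ d

variable [IsProbabilityMeasure P]

theorem condExp_history_mul (hG : IsGenBA P E₀ M C) (hBA1 : BA1 P E₀ M C) (n : ℕ)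
    {u : Ω → ℝ} (hu : Measurable[history E₀ C n] u) {c : ℝ} (huc : ∀ᵐ ω ∂P, ‖u ω‖ ≤ c)
    (φ : ℕ → ℝ) (hφ : Integrable (fun ω => φ (M (n + 1) ω)) P) :
    P[fun ω => u ω * φ (M (n + 1) ω) | history E₀ C n] =ᵐ[P]
      fun ω => u ω * ∫ ω, φ (M (n + 1) ω) ∂P := by
  have h1 := condExp_stronglyMeasurable_mul_of_bound (history_le hG n) hu.stronglyMeasurable hφ c huc
  have hφm : Measurable[MeasurableSpace.comap (M (n + 1)) ⊤] fun ω => φ (M (n + 1) ω) :=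
    fun t _ => ⟨φ ⁻¹' t, trivial, rfl⟩
  have h2 := condExp_indep_eq (hG.measurable_M n).comap_le (history_le hG n)
    hφm.stronglyMeasurable (hBA1.indep n)
  refine h1.trans ?_
  filter_upwards [h2] with ω hω
  rw [Pi.mul_apply, hω]

/-- The strong law applied to `M (i + 1)`, whose conditional mean is its mean by independence. -/
theorem ae_tendsto_card_edges_div (hG : IsGenBA P E₀ M C) (hBA1 : BA1 P E₀ M C) {n₀ : ℕ} {B : ℝ}
    (hM2 : ∀ n, n₀ ≤ n → MemLp (fun ω => (M (n + 1) ω : ℝ)) 2 P ∧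
      ∫ ω, (M (n + 1) ω : ℝ) ^ 2 ∂P ≤ B)
    {μ : ℝ} (hμ : Tendsto (fun n => ∫ ω, (M (n + 1) ω : ℝ) ∂P) atTop (𝓝 μ)) :
    ∀ᵐ ω ∂P, Tendsto (fun n : ℕ => (Multiset.card (edges E₀ C n ω) : ℝ) / n) atTop (𝓝 μ) := by
  -- The history is generated by the graphs alone; this identity makes `M (n + 1)` measurable with
  -- respect to it.
  have hcard : ∀ n ω, (M (n + 1) ω : ℝ) =
      Multiset.card (edges E₀ C (n + 1) ω) - Multiset.card (edges E₀ C n ω) := by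
    intro n ω
    rw [card_edges_succ hG]
    push_cast
    ring
  have hmeas : ∀ i, StronglyMeasurable[historyFiltration hG (i + 1)]
      fun ω => (M (i + 1) ω : ℝ) := by
    intro i
    simp only [hcard]
    refine (Measurable.sub ?_ ?_).stronglyMeasurable
    · exact measurable_history_comp (i + 1) fun e => (Multiset.card e : ℝ)
    · exact (measurable_history_comp i fun e => (Multiset.card e : ℝ)).mono
        ((historyFiltration hG).mono (Nat.le_succ i)) le_rfl
  have hslln := ae_tendsto_sum_sub_condExp_div (P := P) hmeas (fun i hi => (hM2 i hi).1)
    (fun i hi => (hM2 i hi).2)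
  have hce : ∀ i, ∀ᵐ ω ∂P, (P[fun ω => (M (i + 1) ω : ℝ) | historyFiltration hG i]) ω =
      ∫ ω, (M (i + 1) ω : ℝ) ∂P := by
    intro i
    have hφm : Measurable[MeasurableSpace.comap (M (i + 1)) ⊤] fun ω => (M (i + 1) ω : ℝ) :=
      fun t _ => ⟨(fun m : ℕ => (m : ℝ)) ⁻¹' t, trivial, rfl⟩
    exact condExp_indep_eq (hG.measurable_M i).comap_le (history_le hG i)
      hφm.stronglyMeasurable (hBA1.indep i)
  filter_upwards [hslln, ae_all_iff.2 hce] with ω hω1 hω2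
  simp only [hω2] at hω1
  have h1 : ∀ n, ∑ i ∈ Finset.range n, (M (i + 1) ω : ℝ) =
      Multiset.card (edges E₀ C n ω) - Multiset.card (edges E₀ C 0 ω) := by
    intro n
    simp only [hcard]
    exact Finset.sum_range_sub (fun i => (Multiset.card (edges E₀ C i ω) : ℝ)) n
  have h2 : Tendsto (fun n : ℕ => (Multiset.card (edges E₀ C 0 ω) : ℝ) / n) atTop (𝓝 0) :=
    tendsto_const_nhds.div_atTop tendsto_natCast_atTop_atTop
  have h3 := (hω1.add hμ.cesaro).add h2
  rw [zero_add, add_zero] at h3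
  refine h3.congr fun n => ?_
  rw [Finset.sum_sub_distrib, h1]
  ring

theorem ratio_mem_Icc (e : EdgeSet (Vertex s) N) (k : Fin N) :
    0 ≤ (edgeCount e k : ℝ) / Multiset.card e ∧ (edgeCount e k : ℝ) / Multiset.card e ≤ 1 := by
  refine ⟨by positivity, div_le_one_of_le₀ ?_ (by positivity)⟩
  exact_mod_cast edgeCount_le_card e k

theorem martingale_ratio (hE₀ : IsInitial E₀) (h0 : E₀ ≠ 0) (hG : IsGenBA P E₀ M C) (k : Fin N) :
    Martingale (fun n ω => (edgeCount (edges E₀ C n ω) k : ℝ) /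
      (Multiset.card (edges E₀ C n ω) : ℝ)) (historyFiltration hG) P := by
  have hmeas : ∀ n, Measurable[history E₀ C n] fun ω => (edgeCount (edges E₀ C n ω) k : ℝ) /
      (Multiset.card (edges E₀ C n ω) : ℝ) := fun n =>
    measurable_history_comp n fun e => (edgeCount e k : ℝ) / (Multiset.card e : ℝ)
  have hint : ∀ n, Integrable (fun ω => (edgeCount (edges E₀ C n ω) k : ℝ) /
      (Multiset.card (edges E₀ C n ω) : ℝ)) P := by
    intro n
    refine Integrable.of_bound ((hmeas n).mono (history_le hG n) le_rfl).aestronglyMeasurable 1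
      (Eventually.of_forall fun ω => ?_)
    rw [Real.norm_of_nonneg (ratio_mem_Icc _ k).1]
    exact (ratio_mem_Icc _ k).2
  refine martingale_nat (fun n => (hmeas n).stronglyMeasurable) hint fun n => ?_
  have h1 := condExp_historyPlus hG n (fun e l =>
    (edgeCount (attach e (Sum.inr (n + 1)) l) k : ℝ) /
      (Multiset.card (attach e (Sum.inr (n + 1)) l) : ℝ)) (hint (n + 1))
  have h2 : P[fun ω => (edgeCount (edges E₀ C (n + 1) ω) k : ℝ) /
      (Multiset.card (edges E₀ C (n + 1) ω) : ℝ) | historyPlus E₀ C M n] =ᵐ[P]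
      fun ω => (edgeCount (edges E₀ C n ω) k : ℝ) / (Multiset.card (edges E₀ C n ω) : ℝ) := by
    refine h1.trans ?_
    filter_upwards [ae_supportedOn hE₀ hG] with ω hω
    exact listMean_edgeCount_div (hω n) (edges_ne_zero h0 n ω) _ _ k
  -- Tower property: the value obtained given `M (n + 1)` as well is already a function of `G_n`.
  have h3 := condExp_congr_ae (m := history E₀ C n) h2
  have h4 := condExp_condExp_of_le (μ := P) (history_le_historyPlus (M := M) n)
    (historyPlus_le hG n) (f := fun ω => (edgeCount (edges E₀ C (n + 1) ω) k : ℝ) /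
      (Multiset.card (edges E₀ C (n + 1) ω) : ℝ))
  rw [condExp_of_stronglyMeasurable (history_le hG n) (hmeas n).stronglyMeasurable (hint n)] at h3
  exact h3.symm.trans h4

theorem abs_multinomialProb_ratio_le (e : EdgeSet (Vertex s) N) (d : Fin N → ℕ) :
    |multinomialProb (fun k => (edgeCount e k : ℝ) / Multiset.card e) d| ≤
      ((∑ i, d i).factorial : ℝ) / (∏ k, ((d k).factorial : ℝ)) := by
  have h1 : 0 ≤ ∏ k, ((edgeCount e k : ℝ) / Multiset.card e) ^ d k :=
    Finset.prod_nonneg fun k _ => pow_nonneg (ratio_mem_Icc e k).1 _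
  have h2 : ∏ k, ((edgeCount e k : ℝ) / Multiset.card e) ^ d k ≤ 1 :=
    Finset.prod_le_one (fun k _ => pow_nonneg (ratio_mem_Icc e k).1 _)
      fun k _ => pow_le_one₀ (ratio_mem_Icc e k).1 (ratio_mem_Icc e k).2
  rw [multinomialProb, abs_mul, abs_of_nonneg h1, abs_of_nonneg (by positivity)]
  exact mul_le_of_le_one_right (by positivity) h2

theorem memLp_increment (hG : IsGenBA P E₀ M C) (d : Fin N → ℕ) {n : ℕ} {B : ℝ}
    (hM : MemLp (fun ω => (M (n + 1) ω : ℝ)) 2 P) (hB : ∫ ω, (M (n + 1) ω : ℝ) ^ 2 ∂P ≤ B) :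
    MemLp (increment E₀ C d n) 2 P ∧ ∫ ω, increment E₀ C d n ω ^ 2 ∂P ≤ 2 + 2 * B := by
  have h1 : MemLp (fun ω => 1 + (M (n + 1) ω : ℝ)) 2 P :=
    MemLp.add (f := fun _ : Ω => (1 : ℝ)) (memLp_const 1) hM
  have h2 : MemLp (increment E₀ C d n) 2 P := by
    have hm : Measurable (increment E₀ C d n) :=
      (measurable_increment hG d n).mono (history_le hG (n + 1)) le_rfl
    refine h1.of_le hm.aestronglyMeasurable (Eventually.of_forall fun ω => ?_)
    rw [Real.norm_eq_abs, Real.norm_of_nonneg (by positivity)]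
    exact abs_increment_le hG d n ω
  refine ⟨h2, ?_⟩
  have h3 : ∫ ω, increment E₀ C d n ω ^ 2 ∂P ≤ ∫ ω, (2 + 2 * (M (n + 1) ω : ℝ) ^ 2) ∂P := by
    refine integral_mono h2.integrable_sq
      ((integrable_const 2).add (hM.integrable_sq.const_mul 2)) fun ω => ?_
    have h4 := abs_increment_le hG d n ω
    have h5 := sq_abs (increment E₀ C d n ω)
    have h6 := abs_nonneg (increment E₀ C d n ω)
    change increment E₀ C d n ω ^ 2 ≤ 2 + 2 * (M (n + 1) ω : ℝ) ^ 2
    nlinarith [sq_nonneg ((M (n + 1) ω : ℝ) - 1)]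
  rw [integral_add (integrable_const 2) (hM.integrable_sq.const_mul 2), integral_const_mul] at h3
  simp only [integral_const, probReal_univ, smul_eq_mul, one_mul] at h3
  linarith

/-- The one-step estimate holds given `ℱ_n` and `M (n + 1)`. Averaging over the independent `M (n +
1)` replaces `m`, the indicator of `m = D` and `m²` by their expectations. -/
theorem abs_condExp_increment_sub_le (hE₀ : IsInitial E₀) (h0 : E₀ ≠ 0) (hG : IsGenBA P E₀ M C)
    (hBA1 : BA1 P E₀ M C) (d : Fin N → ℕ) {n : ℕ}
    (hM : MemLp (fun ω => (M (n + 1) ω : ℝ)) 2 P) :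
    ∀ᵐ ω ∂P, |(P[increment E₀ C d n | history E₀ C n]) ω -
      (driftPerEdge (vertexSet s n) (edges E₀ C n ω) d * ∫ ω, (M (n + 1) ω : ℝ) ∂P +
        multinomialProb (fun k => (edgeCount (edges E₀ C n ω) k : ℝ) /
          Multiset.card (edges E₀ C n ω)) d * P.real {ω | M (n + 1) ω = ∑ k, d k})| ≤
      ((∑ k, d k : ℕ) : ℝ) / (2 * Multiset.card (edges E₀ C n ω)) *
        ∫ ω, (M (n + 1) ω : ℝ) ^ 2 ∂P := by
  have hsupp := ae_supportedOn hE₀ hG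
  set a : Ω → ℝ := fun ω => driftPerEdge (vertexSet s n) (edges E₀ C n ω) d with ha
  set b : Ω → ℝ := fun ω => multinomialProb (fun k => (edgeCount (edges E₀ C n ω) k : ℝ) /
          Multiset.card (edges E₀ C n ω)) d with hb
  set c : Ω → ℝ := fun ω => ((∑ k, d k : ℕ) : ℝ) / (2 * Multiset.card (edges E₀ C n ω)) with hc
  have ham : Measurable[history E₀ C n] a :=
    measurable_history_comp n fun e => driftPerEdge (vertexSet s n) e d
  have hbm : Measurable[history E₀ C n] b :=
    measurable_history_comp n fun e =>
      multinomialProb (fun k => (edgeCount e k : ℝ) / Multiset.card e) d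
  have hcm : Measurable[history E₀ C n] c :=
    measurable_history_comp n fun e => ((∑ k, d k : ℕ) : ℝ) / (2 * Multiset.card e)
  have habd : ∀ᵐ ω ∂P, ‖a ω‖ ≤ 1 := by
    filter_upwards [hsupp] with ω hω
    exact abs_driftPerEdge_le (hω n) (edges_ne_zero h0 n ω) d
  have hbbd : ∀ᵐ ω ∂P, ‖b ω‖ ≤ ((∑ i, d i).factorial : ℝ) / (∏ k, ((d k).factorial : ℝ)) :=
    Eventually.of_forall fun ω => abs_multinomialProb_ratio_le _ d
  have hcbd : ∀ᵐ ω ∂P, ‖c ω‖ ≤ ((∑ k, d k : ℕ) : ℝ) := Eventually.of_forall fun ω => by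
    have h1 : (1 : ℝ) ≤ Multiset.card (edges E₀ C n ω) := by
      exact_mod_cast Multiset.card_pos.2 (edges_ne_zero h0 n ω)
    rw [Real.norm_of_nonneg (by positivity)]
    exact div_le_self (by positivity) (by linarith)
  set φ₁ : ℕ → ℝ := fun m => m with hφ₁
  set φ₂ : ℕ → ℝ := fun m => if m = ∑ k, d k then 1 else 0 with hφ₂
  set φ₃ : ℕ → ℝ := fun m => (m : ℝ) ^ 2 with hφ₃
  have hi₁ : Integrable (fun ω => φ₁ (M (n + 1) ω)) P := hM.integrable one_le_two
  have hi₂ : Integrable (fun ω => φ₂ (M (n + 1) ω)) P := by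
    refine Integrable.of_bound
      ((measurable_from_top (f := φ₂)).comp (hG.measurable_M n)).aestronglyMeasurable 1
      (Eventually.of_forall fun ω => ?_)
    simp only [hφ₂]
    split_ifs <;> simp
  have hi₃ : Integrable (fun ω => φ₃ (M (n + 1) ω)) P := hM.integrable_sq
  have hle := history_le hG n
  have hai : Integrable (fun ω => a ω * φ₁ (M (n + 1) ω)) P :=
    hi₁.bdd_mul (ham.mono hle le_rfl).aestronglyMeasurable habd
  have hbi : Integrable (fun ω => b ω * φ₂ (M (n + 1) ω)) P :=
    hi₂.bdd_mul (hbm.mono hle le_rfl).aestronglyMeasurable hbbd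
  have hci : Integrable (fun ω => c ω * φ₃ (M (n + 1) ω)) P :=
    hi₃.bdd_mul (hcm.mono hle le_rfl).aestronglyMeasurable hcbd
  have hinc : Integrable (increment E₀ C d n) P :=
    (memLp_increment hG d hM le_rfl).1.integrable one_le_two
  have hplus := condExp_historyPlus hG n (fun e l =>
    (numWithDegree (insert (Sum.inr (n + 1)) (vertexSet s n)) (attach e (Sum.inr (n + 1)) l) d : ℝ) -
      numWithDegree (vertexSet s n) e d) (by
        have h1 := hinc
        unfold increment at h1
        simpa only [vertexSet_succ, edges_succ] using h1)
  have hclose : ∀ᵐ ω ∂P, |(P[increment E₀ C d n | historyPlus E₀ C M n]) ω -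
      ((fun ω => a ω * φ₁ (M (n + 1) ω)) + fun ω => b ω * φ₂ (M (n + 1) ω)) ω| ≤
      c ω * φ₃ (M (n + 1) ω) := by
    have h1 : increment E₀ C d n = fun ω =>
        (numWithDegree (insert (Sum.inr (n + 1)) (vertexSet s n))
          (attach (edges E₀ C n ω) (Sum.inr (n + 1)) (C (n + 1) ω)) d : ℝ) -
        numWithDegree (vertexSet s n) (edges E₀ C n ω) d := by
      ext ω
      rw [increment, vertexSet_succ, edges_succ]
    rw [h1]
    filter_upwards [hplus, hsupp] with ω hω1 hω2
    rw [hω1, mul_comm (c ω), Pi.add_apply, mul_comm (a ω), mul_comm (b ω)]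
    exact abs_listMean_increment_sub_le (hω2 n) (edges_ne_zero h0 n ω)
      (inr_succ_notMem_vertexSet s n) d _
  have h1 := abs_condExp_sub_condExp_le (m := history E₀ C n) integrable_condExp
    (hai.add hbi) hci hclose
  have h2 := condExp_condExp_of_le (μ := P) (f := increment E₀ C d n)
    (history_le_historyPlus (M := M) n) (historyPlus_le hG n)
  have h3 := condExp_add hai hbi (history E₀ C n)
  have h4 := condExp_history_mul hG hBA1 n ham habd φ₁ hi₁
  have h5 := condExp_history_mul hG hBA1 n hbm hbbd φ₂ hi₂
  have h6 := condExp_history_mul hG hBA1 n hcm hcbd φ₃ hi₃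
  have h7 : ∫ ω, φ₂ (M (n + 1) ω) ∂P = P.real {ω | M (n + 1) ω = ∑ k, d k} := by
    have hS : MeasurableSet {ω | M (n + 1) ω = ∑ k, d k} :=
      hG.measurable_M n (measurableSet_singleton _)
    rw [← integral_indicator_one hS]
    refine integral_congr_ae (Eventually.of_forall fun ω => ?_)
    simp [hφ₂, Set.indicator_apply]
  filter_upwards [h1, h2, h3, h4, h5, h6] with ω hω1 hω2 hω3 hω4 hω5 hω6
  rw [hω2, hω3, Pi.add_apply, hω4, hω5, hω6, h7] at hω1
  exact hω1

end Conditional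

/-! ### Almost sure limits and induction on the total degree. -/

section Limits

variable {Ω Ω' : Type*} [MeasurableSpace Ω] [MeasurableSpace Ω'] {P : Measure Ω}
  [IsProbabilityMeasure P] {P' : Measure Ω'} [IsProbabilityMeasure P'] {s N : ℕ}
  {E₀ : EdgeSet (Fin s) N} {M : ℕ → Ω → ℕ} {C : ℕ → Ω → List (Vertex s × Fin N)} {L : Ω' → ℝ}

theorem IsInitial.ne_zero (hE₀ : IsInitial E₀) (hG : IsGenBA P E₀ M C) (hBA1 : BA1 P E₀ M C) :
    E₀ ≠ 0 := by
  rintro rfl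
  obtain ⟨ω, hω⟩ := (hBA1.pos 0).exists
  rw [← hG.length_C 0 ω] at hω
  -- The type of an edge of the first step shows that there is at least one type, so `E₀` cannot be
  -- empty.
  obtain ⟨c, -⟩ := List.exists_mem_of_length_pos hω
  simpa [edgeCount] using hE₀.edgeCount_pos c.2

theorem exists_tendsto_ratio (hE₀ : IsInitial E₀) (hG : IsGenBA P E₀ M C)
    (hBA1 : BA1 P E₀ M C) (k : Fin N) :
    ∃ ζ : Ω → ℝ, Measurable ζ ∧ ∀ᵐ ω ∂P, Tendsto
      (fun n => (edgeCount (edges E₀ C n ω) k : ℝ) / (Multiset.card (edges E₀ C n ω) : ℝ))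
      atTop (𝓝 (ζ ω)) := by
  have hmart := martingale_ratio hE₀ (hE₀.ne_zero hG hBA1) hG k
  refine ⟨_, Filtration.stronglyMeasurable_limit_process'.measurable,
    hmart.submartingale.ae_tendsto_limitProcess (R := 1) fun n => ?_⟩
  refine (eLpNorm_le_of_ae_bound (C := 1) (Eventually.of_forall fun ω => ?_)).trans (by simp)
  rw [Real.norm_of_nonneg (ratio_mem_Icc _ k).1]
  exact (ratio_mem_Icc _ k).2

/-- The right-hand side of the recursion for the limiting degree distribution. -/
noncomputable def limitRec (p : ℝ) (d : Fin N → ℕ) (y : Fin N → ℝ) (z : Fin N → ℝ) : ℝ :=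
  (∑ k, ((d k : ℝ) - 1) / (((∑ i, d i : ℕ) : ℝ) + 2) * (if d k = 0 then 0 else y k)) +
    2 / (((∑ i, d i : ℕ) : ℝ) + 2) * p *
      (((∑ i, d i).factorial : ℝ) / ∏ k, ((d k).factorial : ℝ)) * ∏ k, z k ^ d k

theorem ae_tendsto_numWithDegree_div (hE₀ : IsInitial E₀) (hG : IsGenBA P E₀ M C)
    (hBA1 : BA1 P E₀ M C) (hBA2 : BA2 P P' M L) {ζ : Fin N → Ω → ℝ}
    (hζ : ∀ k, ∀ᵐ ω ∂P, Tendsto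
      (fun n => (edgeCount (edges E₀ C n ω) k : ℝ) / (Multiset.card (edges E₀ C n ω) : ℝ))
      atTop (𝓝 (ζ k ω))) (d : Fin N → ℕ) {y : Fin N → Ω → ℝ}
    (hy : ∀ k, d k ≠ 0 → ∀ᵐ ω ∂P, Tendsto
      (fun n : ℕ => (numWithDegree (vertexSet s n) (edges E₀ C n ω) (d - Pi.single k 1) : ℝ) / n)
      atTop (𝓝 (y k ω))) :
    ∀ᵐ ω ∂P, Tendsto
      (fun n : ℕ => (numWithDegree (vertexSet s n) (edges E₀ C n ω) d : ℝ) / n) atTop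
      (𝓝 (limitRec (P'.real {ω' | L ω' = ((∑ i, d i : ℕ) : ℝ)}) d (fun k => y k ω)
        fun k => ζ k ω)) := by
  have h0 := hE₀.ne_zero hG hBA1
  obtain ⟨n₀, B, hM2⟩ := hBA2.exists_memLp_two hG.measurable_M
  obtain ⟨μ, hμ1, hμ⟩ := hBA2.exists_tendsto_mean hG.measurable_M hBA1.pos
  have hprob := hBA2.tendsto_prob (∑ i, d i)
  set D : ℝ := ((∑ i, d i : ℕ) : ℝ) with hD
  have hD0 : 0 ≤ D := Nat.cast_nonneg _
  have hnoise := ae_tendsto_sum_sub_condExp_div (P := P) (ℱ := historyFiltration hG)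
    (f := increment E₀ C d) (fun i => (measurable_increment hG d i).stronglyMeasurable)
    (fun i hi => (memLp_increment hG d (hM2 i hi).1 (hM2 i hi).2).1)
    (fun i hi => (memLp_increment hG d (hM2 i hi).1 (hM2 i hi).2).2)
  have hdrift : ∀ᵐ ω ∂P, ∀ n, n₀ ≤ n → |(P[increment E₀ C d n | history E₀ C n]) ω -
      (driftPerEdge (vertexSet s n) (edges E₀ C n ω) d * ∫ ω, (M (n + 1) ω : ℝ) ∂P +
        multinomialProb (fun k => (edgeCount (edges E₀ C n ω) k : ℝ) /
          Multiset.card (edges E₀ C n ω)) d * P.real {ω | M (n + 1) ω = ∑ k, d k})| ≤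
      D / (2 * Multiset.card (edges E₀ C n ω)) * ∫ ω, (M (n + 1) ω : ℝ) ^ 2 ∂P := by
    refine ae_all_iff.2 fun n => ?_
    by_cases hn : n₀ ≤ n
    · filter_upwards [abs_condExp_increment_sub_le hE₀ h0 hG hBA1 d (hM2 n hn).1] with ω hω _
        using hω
    · exact Eventually.of_forall fun ω h => absurd h hn
  have hy' : ∀ᵐ ω ∂P, ∀ k, d k ≠ 0 → Tendsto
      (fun n : ℕ => (numWithDegree (vertexSet s n) (edges E₀ C n ω) (d - Pi.single k 1) : ℝ) / n)
      atTop (𝓝 (y k ω)) := by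
    refine ae_all_iff.2 fun k => ?_
    by_cases hk : d k ≠ 0
    · filter_upwards [hy k hk] with ω hω _ using hω
    · exact Eventually.of_forall fun ω h => absurd h hk
  filter_upwards [hnoise, hdrift, hy', ae_all_iff.2 hζ, ae_tendsto_card_edges_div hG hBA1 hM2 hμ]
    with ω hnoise hdrift hy hζ hS
  set S : ℕ → ℝ := fun n => (Multiset.card (edges E₀ C n ω) : ℝ) with hSdef
  set X : ℕ → ℝ := fun n => (numWithDegree (vertexSet s n) (edges E₀ C n ω) d : ℝ) with hX
  set m₁ : ℕ → ℝ := fun n => ∫ ω, (M (n + 1) ω : ℝ) ∂P with hm₁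
  set m₂ : ℕ → ℝ := fun n => ∫ ω, (M (n + 1) ω : ℝ) ^ 2 ∂P with hm₂
  set drift : ℕ → ℝ := fun n => (P[increment E₀ C d n | history E₀ C n]) ω with hdr
  set a : ℕ → ℝ := fun n => driftPerEdge (vertexSet s n) (edges E₀ C n ω) d with ha
  set b : ℕ → ℝ := fun n => multinomialProb (fun k => (edgeCount (edges E₀ C n ω) k : ℝ) /
          Multiset.card (edges E₀ C n ω)) d with hb
  set t : ℕ → ℝ := fun n => ∑ k, (if d k = 0 then 0 else ((d k : ℝ) - 1) *
    numWithDegree (vertexSet s n) (edges E₀ C n ω) (d - Pi.single k 1)) with ht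
  have hμ0 : μ ≠ 0 := by positivity
  have hSpos : ∀ n, 0 < S n := fun n =>
    Nat.cast_pos.2 (Multiset.card_pos.2 (edges_ne_zero h0 n ω))
  have hinv : Tendsto (fun n : ℕ => (n : ℝ) / S n) atTop (𝓝 μ⁻¹) :=
    (hS.inv₀ hμ0).congr fun n => inv_div _ _
  have hSinv : Tendsto (fun n => (S n)⁻¹) atTop (𝓝 0) := by
    have h1 := hinv.mul (tendsto_inv_atTop_zero.comp (tendsto_natCast_atTop_atTop (R := ℝ)))
    rw [mul_zero] at h1
    refine h1.congr' ?_
    filter_upwards [eventually_gt_atTop 0] with n hn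
    have h2 : (n : ℝ) ≠ 0 := by positivity
    have h3 := (hSpos n).ne'
    simp only [Function.comp_apply]
    field_simp
  have hm₁0 : ∀ n, 0 ≤ m₁ n := fun n => integral_nonneg fun ω => Nat.cast_nonneg _
  -- `γ n = D m₁ n / (2 S n)` is the rate at which vertices leave degree `d`; the mean `μ` cancels.
  have hγa : Tendsto (fun n : ℕ => (n : ℝ) * (D * m₁ n / (2 * S n))) atTop (𝓝 (D / 2)) := by
    have h1 := ((hμ.const_mul D).div_const 2).mul hinv
    have h2 : D * μ / 2 * μ⁻¹ = D / 2 := by field_simp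
    rw [h2] at h1
    refine h1.congr fun n => ?_
    have h3 := (hSpos n).ne'
    field_simp
  have herr : Tendsto (fun n => drift n - (a n * m₁ n + b n *
      P.real {ω | M (n + 1) ω = ∑ k, d k})) atTop (𝓝 0) := by
    have h1 : Tendsto (fun n => D / 2 * B * (S n)⁻¹) atTop (𝓝 (D / 2 * B * 0)) :=
      hSinv.const_mul _
    rw [mul_zero] at h1
    refine squeeze_zero_norm' ?_ h1
    filter_upwards [eventually_ge_atTop n₀] with n hn
    rw [Real.norm_eq_abs]
    refine (hdrift n hn).trans ?_
    have h2 := hSpos n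
    have h3 : D / 2 * B * (S n)⁻¹ = D / (2 * S n) * B := by field_simp
    rw [h3]
    exact mul_le_mul_of_nonneg_left (hM2 n hn).2 (by positivity)
  have hbt : Tendsto b atTop (𝓝 (multinomialProb (fun k => ζ k ω) d)) :=
    (tendsto_finsetProd _ fun k _ => (hζ k).pow (d k)).const_mul _
  have htt : Tendsto (fun n : ℕ => t n / n) atTop
      (𝓝 (∑ k, (if d k = 0 then 0 else ((d k : ℝ) - 1) * y k ω))) := by
    simp only [ht, Finset.sum_div]
    refine tendsto_finsetSum _ fun k _ => ?_
    split_ifs with hk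
    · simp
    · simp only [mul_div_assoc]
      exact (hy k hk).const_mul _
  -- The outflow is carried by `γ`, so adding it back leaves only the inflow from the degrees `d -
  -- e_k`.
  have hlin : Tendsto (fun n => a n * m₁ n + D * m₁ n / (2 * S n) * X n) atTop
      (𝓝 ((∑ k, (if d k = 0 then 0 else ((d k : ℝ) - 1) * y k ω)) / 2)) := by
    have h1 := ((hμ.div_const 2).mul hinv).mul htt
    have h2 : ∀ z : ℝ, μ / 2 * μ⁻¹ * z = z / 2 := fun z => by field_simp
    rw [h2] at h1
    refine h1.congr' ?_
    filter_upwards [eventually_gt_atTop 0] with n hn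
    have h3 : (n : ℝ) ≠ 0 := by positivity
    have h4 := (hSpos n).ne'
    have h5 : a n = (t n - D * X n) / (2 * S n) := rfl
    rw [h5]
    change m₁ n / 2 * (n / S n) * (t n / n) = _
    field_simp
    ring
  have hβ := (herr.add hlin).add (hbt.mul hprob)
  rw [zero_add] at hβ
  have hfin := tendsto_div_nat_of_recursion (X := X) (γ := fun n => D * m₁ n / (2 * S n))
    (β := fun n => drift n - (a n * m₁ n + b n * P.real {ω | M (n + 1) ω = ∑ k, d k}) +
      (a n * m₁ n + D * m₁ n / (2 * S n) * X n) + b n * P.real {ω | M (n + 1) ω = ∑ i, d i})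
    (ξ := fun n => increment E₀ C d n ω - drift n) (by positivity) ?_ ?_ hγa hβ hnoise
  · convert hfin using 2
    -- Division by `1 + D / 2` produces the denominators `D + 2`.
    rw [limitRec, multinomialProb, ← hD, add_div, Finset.sum_div, Finset.sum_div]
    have h1 : D + 2 ≠ 0 := by positivity
    have h2 : 1 + D / 2 ≠ 0 := by positivity
    have h3 : 1 + D / 2 = (D + 2) / 2 := by ring
    congr 1
    · refine Finset.sum_congr rfl fun k _ => ?_
      rw [h3]
      split_ifs
      · simp
      · field_simp
    · rw [h3]
      field_simp
  · intro n
    have h1 : increment E₀ C d n ω = X (n + 1) - X n := rfl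
    rw [h1]
    ring
  · intro n
    exact div_nonneg (mul_nonneg hD0 (hm₁0 n)) (mul_nonneg zero_le_two (hSpos n).le)

theorem exists_tendsto_numWithDegree_div (hE₀ : IsInitial E₀) (hG : IsGenBA P E₀ M C)
    (hBA1 : BA1 P E₀ M C) (hBA2 : BA2 P P' M L) {ζ : Fin N → Ω → ℝ} (hζm : ∀ k, Measurable (ζ k))
    (hζ : ∀ k, ∀ᵐ ω ∂P, Tendsto
      (fun n => (edgeCount (edges E₀ C n ω) k : ℝ) / (Multiset.card (edges E₀ C n ω) : ℝ))
      atTop (𝓝 (ζ k ω))) (D : ℕ) : ∀ d : Fin N → ℕ, ∑ i, d i = D →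
    ∃ x : Ω → ℝ, Measurable x ∧ ∀ᵐ ω ∂P, Tendsto
      (fun n : ℕ => (numWithDegree (vertexSet s n) (edges E₀ C n ω) d : ℝ) / n) atTop
      (𝓝 (x ω)) := by
  induction D with
  | zero =>
    intro d hd
    have h0 : ∀ k, d k = 0 := fun k => Finset.sum_eq_zero_iff.1 hd k (Finset.mem_univ k)
    refine ⟨_, ?_, ae_tendsto_numWithDegree_div hE₀ hG hBA1 hBA2 hζ d (y := fun _ _ => 0)
      fun k hk => absurd (h0 k) hk⟩
    simp only [limitRec]
    fun_prop
  | succ D ih =>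
    intro d hd
    have h1 : ∀ k, ∃ x : Ω → ℝ, Measurable x ∧ (d k ≠ 0 → ∀ᵐ ω ∂P, Tendsto
        (fun n : ℕ => (numWithDegree (vertexSet s n) (edges E₀ C n ω) (d - Pi.single k 1) : ℝ) / n)
        atTop (𝓝 (x ω))) := by
      intro k
      by_cases hk : d k = 0
      -- Here truncated subtraction leaves `d - e_k` equal to `d`; `limitRec` ignores this
      -- coordinate, so any value serves.
      · exact ⟨0, measurable_zero, fun h => absurd hk h⟩
      · obtain ⟨x, hxm, hx⟩ := ih (d - Pi.single k 1) (by
          have := sum_sub_single hk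
          omega)
        exact ⟨x, hxm, fun _ => hx⟩
    choose y hym hy using h1
    refine ⟨_, ?_, ae_tendsto_numWithDegree_div hE₀ hG hBA1 hBA2 hζ d hy⟩
    have h2 : ∀ k, Measurable fun ω => if d k = 0 then (0 : ℝ) else y k ω := by
      intro k
      split_ifs
      · exact measurable_const
      · exact hym k
    simp only [limitRec]
    fun_prop

end Limits

end MultiTypeBA

theorem mainTheorem2 {Ω Ω' : Type*} [MeasurableSpace Ω] [MeasurableSpace Ω']
    (P : Measure Ω) [IsProbabilityMeasure P] (P' : Measure Ω') [IsProbabilityMeasure P']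
    (s N : ℕ) (E₀ : MultiTypeBA.EdgeSet (Fin s) N) (hE₀ : MultiTypeBA.IsInitial E₀)
    (M : ℕ → Ω → ℕ) (C : ℕ → Ω → List (MultiTypeBA.Vertex s × Fin N)) (L : Ω' → ℝ)
    (hG : MultiTypeBA.IsGenBA P E₀ M C)
    (hBA1 : MultiTypeBA.BA1 P E₀ M C) (hBA2 : MultiTypeBA.BA2 P P' M L) :
    ∃ (ζ : Fin N → Ω → ℝ) (x : (Fin N → ℕ) → Ω → ℝ),
      (∀ k, Measurable (ζ k)) ∧ (∀ d, Measurable (x d)) ∧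
      (∀ k, ∀ᵐ ω ∂P, Tendsto
        (fun n => (MultiTypeBA.edgeCount (MultiTypeBA.edges E₀ C n ω) k : ℝ) /
          (Multiset.card (MultiTypeBA.edges E₀ C n ω) : ℝ)) atTop (𝓝 (ζ k ω))) ∧
      (∀ d, ∀ᵐ ω ∂P, Tendsto
        (fun n => (MultiTypeBA.numWithDegree (MultiTypeBA.vertexSet s n)
            (MultiTypeBA.edges E₀ C n ω) d : ℝ) /
          ((MultiTypeBA.vertexSet s n).card : ℝ)) atTop (𝓝 (x d ω))) ∧
      (∀ d : Fin N → ℕ, ∀ᵐ ω ∂P,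
        x d ω =
          (∑ k, ((d k : ℝ) - 1) / (((∑ i, d i : ℕ) : ℝ) + 2) *
            (if d k = 0 then 0 else x (d - Pi.single k 1) ω)) +
          2 / (((∑ i, d i : ℕ) : ℝ) + 2) * P'.real {ω' | L ω' = ((∑ i, d i : ℕ) : ℝ)} *
            (((∑ i, d i).factorial : ℝ) / ∏ k, ((d k).factorial : ℝ)) *
            ∏ k, ζ k ω ^ d k) := by
  choose ζ hζm hζ using MultiTypeBA.exists_tendsto_ratio hE₀ hG hBA1
  choose x hxm hx using fun d : Fin N → ℕ =>
    MultiTypeBA.exists_tendsto_numWithDegree_div hE₀ hG hBA1 hBA2 hζm hζ _ d rfl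
  refine ⟨ζ, x, hζm, hxm, hζ, fun d => ?_, fun d => ?_⟩
  · filter_upwards [hx d] with ω hω
    -- The vertex set has `s + n` elements, so the normalizations by `n` and by its size are
    -- asymptotically equal.
    have h1 := hω.mul (tendsto_natCast_div_add_atTop (s : ℝ))
    rw [mul_one] at h1
    refine h1.congr' ?_
    filter_upwards [eventually_gt_atTop 0] with n hn
    have h2 : (n : ℝ) ≠ 0 := by positivity
    rw [MultiTypeBA.card_vertexSet, div_mul_div_cancel₀ h2]
    push_cast
    rw [add_comm]
  -- Feeding the chosen limits into the drift computation gives a second expression for the same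
  -- limit; uniqueness yields the recursion.
  · filter_upwards [hx d, MultiTypeBA.ae_tendsto_numWithDegree_div hE₀ hG hBA1 hBA2 hζ d
      (y := fun k => x (d - Pi.single k 1)) fun k _ => hx _] with ω hω1 hω2
    exact tendsto_nhds_unique hω1 hω2
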